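/- Let $\mathbb F$ be a field whose characteristic does not divide $|S_4| = 24$ (characteristic $0$ is allowed). For a finite group $G$ and a finite dimensional $\mathbb F$-vector space $V$ with a linear action of $G$, let $G$ act on $\mathbb F[V]=\mathbb F[x_1,\dots,x_n]$ (where $x_1,\dots,x_n$ are the coordinate functions on $V$) by $(g\cdot x)(v)=x(g^{-1}v)$ for linear forms $x$. Let $\mathbb F[V]^G$ be the ring of invariants and $\mathbb F[V]^G_+$ the span of its homogeneous elements of positive degree. For $k\ge 1$ let $\beta_k(G,V)$ be the top degree of the graded space $\mathbb F[V]^G_+/(\mathbb F[V]^G_+)^{k+1}$, let $\beta_k(G)$ be the supremum of $\beta_k(G,V)$ over all finite dimensional $G$-modules $V$ over $\mathbb F$, and put $\beta(G,V)=\beta_1(G,V)$ and $\beta(G)=\beta_1(G)$ (the Noether number of $G$). For a finite group $G$ let $\mathsf D_k(G)$ be the supremum of the lengths of those product-one sequences over $G$ (finite unordered sequences whose terms can be ordered so that their product is $1$) that are not a concatenation of more than $k$ minimal nontrivial product-one sequences. Then: 1. The Noether number of the symmetric group $S_4$ is $\beta(S_4)=9$. 2. $S_4$ has a normal subgroup $N\cong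 C_2\oplus C_2$ with $S_4/N\cong D_6$, the dihedral group of order $6$; moreover $\beta(D_6)=4$ and $$\beta(S_4)\le \beta_{\beta(D_6)}(C_2\oplus C_2)=\mathsf D_4(C_2\oplus C_2)=9.$$ 3. Let $V=\mathbb F^4$ be the standard permutation representation of $S_4$, let $\mathrm{sign}$ be the sign character, let $\sigma_i$ be the $i$-th elementary symmetric polynomial in $x_1,\dots,x_4$ and let $\Delta_4=\prod_{i<j}(x_j-x_i)$. Identify the underlying vector space of $V\otimes\mathrm{sign}$ with $V$. Then $$\mathbb F[V\otimes \mathrm{sign}]^{S_4}=\mathbb F[V]^{S_4}_{even}\oplus \Delta_4\,\mathbb F[V]^{S_4}_{odd},$$ where $\mathbb F[V]^{S_4}_{even}$ and $\mathbb F[V]^{S_4}_{odd}$ are the spans of the homogeneous elements of even, respectively odd, degree of $\mathbb F[V]^{S_4}$. This algebra is minimally generated by the homogeneous elements $$\sigma_2,\ \sigma_1^2,\ \sigma_1\sigma_3,\ \sigma_4,\ \sigma_3^2,\ \sigma_1\Delta_4,\ \sigma_3\Delta_4,$$ and $\beta(S_4,V\otimes\mathrm{sign})=\deg(\sigma_3\Delta_4)=9$.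 -/

import Mathlib

open scoped BigOperators

namespace NoetherNumber

noncomputable section

section Invariants

variable {F : Type*} [Field F] {G : Type*} [Group G] {n : ℕ}

/-- A finite dimensional `G`-module over `F` is, after the choice of a basis, a representation
`ρ` of `G` on `Fⁿ`.  The group acts on `F[V] = F[x₁, …, xₙ]`, where `x_j` is the `j`-th coordinate
function of `V = Fⁿ`, by the `F`-algebra homomorphisms with `(g · x_j)(v) = x_j(ρ(g⁻¹) v)`, that
is, `g · x_j = ∑ i, ρ(g⁻¹)_{j i} x_i`. -/
def polyAct (ρ : Representation F G (Fin n → F)) (g : G) :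
    MvPolynomial (Fin n) F →ₐ[F] MvPolynomial (Fin n) F :=
  MvPolynomial.aeval fun j =>
    ∑ i, MvPolynomial.C (LinearMap.toMatrix' (ρ g⁻¹) j i) * MvPolynomial.X i

/-- The ring of polynomial invariants `F[V]^G`. -/
def invariants (ρ : Representation F G (Fin n → F)) : Subalgebra F (MvPolynomial (Fin n) F) where
  carrier := {f | ∀ g : G, polyAct ρ g f = f}
  mul_mem' := fun ha hb g => by rw [map_mul, ha g, hb g]
  add_mem' := fun ha hb g => by rw [map_add, ha g, hb g]
  algebraMap_mem' := fun r g => (polyAct ρ g).commutes r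

/-- `F[V]^G_+`: the span of the homogeneous invariants of positive degree. -/
def posInvariants (ρ : Representation F G (Fin n → F)) :
    Submodule F (MvPolynomial (Fin n) F) :=
  Submodule.span F {f | f ∈ invariants ρ ∧ ∃ d : ℕ, 0 < d ∧ f.IsHomogeneous d}

/-- `β_k(G, V)`: the top degree of the graded space `F[V]^G_+ / (F[V]^G_+)^(k+1)`, where the power
of a subspace `S` is the span of the products of `k + 1` elements of `S`. -/
def betaModule (ρ : Representation F G (Fin n → F)) (k : ℕ) : ℕ∞ :=
  ⨆ d ∈ {d : ℕ | ∃ f ∈ posInvariants ρ, f.IsHomogeneous d ∧ f ∉ posInvariants ρ ^ (k + 1)},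
    (d : ℕ∞)

/-- The `k`-th Noether number `β_k(G)` over `F`: the supremum of `β_k(G, V)` over all finite
dimensional `G`-modules `V` over `F`.  The Noether number is `β(G) = β_1(G)`. -/
def beta (F : Type*) [Field F] (G : Type*) [Group G] (k : ℕ) : ℕ∞ :=
  ⨆ (n : ℕ) (ρ : Representation F G (Fin n → F)), betaModule ρ k

/-- `S` is a minimal homogeneous generating set of the `F`-algebra `A ⊆ F[x₁, …, xₙ]`. -/
def IsMinimalHomogeneousGeneratingSet (A : Subalgebra F (MvPolynomial (Fin n) F))
    (S : Set (MvPolynomial (Fin n) F)) : Prop :=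
  (∀ f ∈ S, ∃ d : ℕ, f.IsHomogeneous d) ∧ Algebra.adjoin F S = A ∧
    ∀ T : Set (MvPolynomial (Fin n) F), T ⊂ S → Algebra.adjoin F T ≠ A

/-- The span of the homogeneous elements of even degree of `A ⊆ F[x₁, …, xₙ]`. -/
def evenPart (A : Subalgebra F (MvPolynomial (Fin n) F)) : Submodule F (MvPolynomial (Fin n) F) :=
  Submodule.span F {f | f ∈ A ∧ ∃ d : ℕ, Even d ∧ f.IsHomogeneous d}

/-- The span of the homogeneous elements of odd degree of `A ⊆ F[x₁, …, xₙ]`. -/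
def oddPart (A : Subalgebra F (MvPolynomial (Fin n) F)) : Submodule F (MvPolynomial (Fin n) F) :=
  Submodule.span F {f | f ∈ A ∧ ∃ d : ℕ, Odd d ∧ f.IsHomogeneous d}

end Invariants

section SymmetricGroup

variable (F : Type*) [Field F] (n : ℕ)

/-- The standard permutation representation of the symmetric group on `Fⁿ`, which maps the
standard basis vector `e_i` to `e_{σ i}`. -/
def permRep : Representation F (Equiv.Perm (Fin n)) (Fin n → F) where
  toFun σ := LinearMap.funLeft F F σ.symm
  map_one' := rfl
  map_mul' _ _ := rfl

/-- `V ⊗ sign` for the permutation representation `V = Fⁿ`: the underlying space is identified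
with `V`, and `σ` acts by `sign σ` times its action on `V`. -/
def permSignRep : Representation F (Equiv.Perm (Fin n)) (Fin n → F) where
  toFun σ := ((Equiv.Perm.sign σ : ℤ) : F) • permRep F n σ
  map_one' := by simp
  map_mul' σ τ := by
    simp only [map_mul, Units.val_mul, Int.cast_mul]
    rw [smul_mul_smul_comm]

/-- The Vandermonde determinant `Δₙ` in the variables `x₁, …, xₙ`. -/
def vdm : MvPolynomial (Fin n) F :=
  (Matrix.vandermonde fun i : Fin n => (MvPolynomial.X i : MvPolynomial (Fin n) F)).det

end SymmetricGroup

section Davenport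

variable {G : Type*} [Group G]

/-- A sequence over `G` (a finite unordered sequence of elements, repetition allowed) is a
product-one sequence if its terms can be ordered so that their product is `1`. -/
def IsProductOne (S : Multiset G) : Prop :=
  ∃ l : List G, (l : Multiset G) = S ∧ l.prod = 1

/-- The atoms of the monoid `B(G)` of product-one sequences over `G`: the nontrivial product-one
sequences that are not a concatenation of two nontrivial product-one sequences. -/
def IsMinimalProductOne (S : Multiset G) : Prop :=
  IsProductOne S ∧ S ≠ 0 ∧
    ∀ A B : Multiset G, IsProductOne A → IsProductOne B → S = A + B → A = 0 ∨ B = 0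

/-- The set of lengths `L(S)`: all `m` such that `S` is a concatenation of `m` atoms. -/
def lengths (S : Multiset G) : Set ℕ :=
  {m | ∃ A : Multiset (Multiset G), Multiset.card A = m ∧ (∀ U ∈ A, IsMinimalProductOne U) ∧ A.sum = S}

/-- The `k`-th (large) Davenport constant `D_k(G)`: the supremum of the lengths `|S|` of the
product-one sequences `S` over `G` with `max L(S) ≤ k`. -/
def davenport (G : Type*) [Group G] (k : ℕ) : ℕ∞ :=
  ⨆ S ∈ {S : Multiset G | IsProductOne S ∧ ∀ m ∈ lengths S, m ≤ k}, (Multiset.card S : ℕ∞)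

end Davenport

/-- The group `C₂ ⊕ C₂`, written multiplicatively. -/
abbrev KleinFour : Type := Multiplicative (ZMod 2) × Multiplicative (ZMod 2)

/-- The symmetric group `S₄`. -/
abbrev S4 : Type := Equiv.Perm (Fin 4)

end

end NoetherNumber

namespace NoetherNumber

open MvPolynomial
open scoped Pointwise TensorProduct

/-! ### The group action on polynomials and its homogeneous components -/

section Action

variable {F : Type*} [Field F] {G : Type*} [Group G] {n : ℕ}

/-! Upper bound. Let P be the space of polynomials without constant term and N the normal Klein
four-group. A homogeneous invariant of degree at least 10 lies in P^10. Diagonalising N, which is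
possible as 2 is invertible, P^10 is spanned by products of ten weight vectors. Averaging over N
kills the products of nontrivial total weight; each of the others splits into five blocks of trivial
weight, because among any four elements of the Klein group one or two already multiply to 1. So an
N-invariant in P^10 lies in the fifth power of P^N (`klein_mem_fixedPart_pow`). The quotient by N is
the symmetric group of degree three, and for an action of that group every invariant in the fifth
power of a stable, multiplicatively closed subspace is a sum of products of two invariants
(`S3Action.mem_fixedPart_sq`). Applied to P this gives the bound 4 for the dihedral group, and
applied to P^N it gives the bound 9 for S₄.

Lower bound. On V ⊗ sign a permutation acts in degree d by the d-th power of its sign times the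
permutation action. Invariants of even degree are thus symmetric, and those of odd degree are
antisymmetric, hence Δ times a symmetric polynomial (`IsAntisymmetric.exists_eq_vdm_mul`). Sorting
the monomials in the σ_i by parity yields the seven generators. Invariants of odd degree below 9 are
multiples of σ₁. If two positive-degree invariants have degrees adding to 9, one of these degrees is
odd and below 9, so their product lies in the ideal (σ₁), which does not contain σ₃Δ
(`le_betaModule_permSignRep`).

Minimality of the generators: for each of the first five there are two points at which all the
others agree and it does not; the two multiples of Δ are separated by degree and by the ideal (σ₁).
-/

theorem polyAct_X (ρ : Representation F G (Fin n → F)) (g : G) (j : Fin n) :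
    polyAct ρ g (X j) = ∑ i, C (LinearMap.toMatrix' (ρ g⁻¹) j i) * X i := by
  simp [polyAct]

theorem polyAct_mul (ρ : Representation F G (Fin n → F)) (g h : G)
    (f : MvPolynomial (Fin n) F) : polyAct ρ (g * h) f = polyAct ρ g (polyAct ρ h f) := by
  have key : polyAct ρ (g * h) = (polyAct ρ g).comp (polyAct ρ h) := by
    refine MvPolynomial.algHom_ext fun j => ?_
    rw [AlgHom.comp_apply, polyAct_X, polyAct_X, map_sum]
    simp only [map_mul, polyAct_X, algHom_C, algebraMap_eq, Finset.mul_sum]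
    rw [Finset.sum_comm]
    refine Finset.sum_congr rfl fun i _ => ?_
    simp only [← mul_assoc, ← C_mul]
    rw [← Finset.sum_mul, ← map_sum]
    congr 2
    rw [mul_inv_rev, map_mul, Module.End.mul_eq_comp, LinearMap.toMatrix'_comp, Matrix.mul_apply]
  exact DFunLike.congr_fun key f

theorem polyAct_one (ρ : Representation F G (Fin n → F)) (f : MvPolynomial (Fin n) F) :
    polyAct ρ 1 f = f := by
  have key : polyAct ρ 1 = AlgHom.id F _ := by
    refine MvPolynomial.algHom_ext fun j => ?_
    rw [polyAct_X, inv_one, map_one, Module.End.one_eq_id, LinearMap.toMatrix'_id]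
    simp [Matrix.one_apply, Finset.sum_ite_eq]
  exact DFunLike.congr_fun key f

theorem polyAct_isHomogeneous (ρ : Representation F G (Fin n → F)) (g : G)
    {f : MvPolynomial (Fin n) F} {d : ℕ} (hf : f.IsHomogeneous d) :
    (polyAct ρ g f).IsHomogeneous d := by
  have h := hf.aeval (S := F) (n := 1)
    (fun j => ∑ i, C (LinearMap.toMatrix' (ρ g⁻¹) j i) * X i) (fun j =>
      IsHomogeneous.sum _ _ _ fun i _ => isHomogeneous_C_mul_X _ _)
  rwa [one_mul] at h

theorem homogeneousComponent_polyAct (ρ : Representation F G (Fin n → F)) (g : G)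
    (f : MvPolynomial (Fin n) F) (d : ℕ) :
    homogeneousComponent d (polyAct ρ g f) = polyAct ρ g (homogeneousComponent d f) := by
  classical
  conv_lhs => rw [← sum_homogeneousComponent f, map_sum, map_sum]
  simp only [homogeneousComponent_of_mem
    (polyAct_isHomogeneous ρ g (homogeneousComponent_isHomogeneous _ f))]
  rw [Finset.sum_ite_eq]
  split_ifs with h
  · rfl
  · rw [homogeneousComponent_eq_zero _ _ (by simpa using h), map_zero]

theorem homogeneousComponent_mem_invariants {ρ : Representation F G (Fin n → F)}
    {f : MvPolynomial (Fin n) F} (hf : f ∈ invariants ρ) (d : ℕ) :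
    homogeneousComponent d f ∈ invariants ρ := fun g => by
  rw [← homogeneousComponent_polyAct, hf g]

/-- The polynomials with vanishing constant term. -/
def augmentation (F : Type*) [Field F] (n : ℕ) : Submodule F (MvPolynomial (Fin n) F) where
  carrier := {f | constantCoeff f = 0}
  zero_mem' := map_zero _
  add_mem' := fun {a b} ha hb => by
    change constantCoeff (a + b) = 0
    rw [map_add, show constantCoeff a = 0 from ha, show constantCoeff b = 0 from hb, add_zero]
  smul_mem' := fun c f hf => by
    change constantCoeff (c • f) = 0
    rw [smul_eq_C_mul, map_mul, show constantCoeff f = 0 from hf, mul_zero]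

theorem mem_augmentation {f : MvPolynomial (Fin n) F} :
    f ∈ augmentation F n ↔ constantCoeff f = 0 := Iff.rfl

theorem isHomogeneous_mem_augmentation {f : MvPolynomial (Fin n) F} {d : ℕ}
    (hf : f.IsHomogeneous d) (hd : 0 < d) : f ∈ augmentation F n := by
  rw [mem_augmentation, constantCoeff_eq]
  exact hf.coeff_eq_zero (by simpa using hd.ne)

theorem augmentation_mul {f g : MvPolynomial (Fin n) F} (hf : f ∈ augmentation F n) :
    f * g ∈ augmentation F n := by
  rw [mem_augmentation] at *
  rw [map_mul, hf, zero_mul]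

theorem homogeneousComponent_zero_of_mem_augmentation {f : MvPolynomial (Fin n) F}
    (hf : f ∈ augmentation F n) : homogeneousComponent 0 f = 0 := by
  rw [homogeneousComponent_zero, ← constantCoeff_eq, mem_augmentation.1 hf, map_zero]

theorem polyAct_mem_augmentation (ρ : Representation F G (Fin n → F)) (g : G)
    {f : MvPolynomial (Fin n) F} (hf : f ∈ augmentation F n) :
    polyAct ρ g f ∈ augmentation F n := by
  have h : homogeneousComponent 0 (polyAct ρ g f) = 0 := by
    rw [homogeneousComponent_polyAct, homogeneousComponent_zero_of_mem_augmentation hf, map_zero]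
  rw [homogeneousComponent_zero, ← constantCoeff_eq] at h
  exact C_eq_zero.1 h

/-- Homogeneous components of invariants are invariant, so the span in the definition can be
replaced by two conditions that are checked directly. -/
theorem mem_posInvariants {ρ : Representation F G (Fin n → F)} {f : MvPolynomial (Fin n) F} :
    f ∈ posInvariants ρ ↔ f ∈ invariants ρ ∧ f ∈ augmentation F n := by
  constructor
  · intro h
    have hle : posInvariants ρ ≤ Subalgebra.toSubmodule (invariants ρ) ⊓ augmentation F n :=
      Submodule.span_le.2 fun f ⟨hf, d, hd, hfd⟩ => ⟨hf, isHomogeneous_mem_augmentation hfd hd⟩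
    exact hle h
  · rintro ⟨hf, h0⟩
    rw [← sum_homogeneousComponent f]
    refine Submodule.sum_mem _ fun d _ => ?_
    rcases Nat.eq_zero_or_pos d with rfl | hd
    · rw [homogeneousComponent_zero_of_mem_augmentation h0]
      exact Submodule.zero_mem _
    · exact Submodule.subset_span ⟨homogeneousComponent_mem_invariants hf d, d, hd,
        homogeneousComponent_isHomogeneous d f⟩

/-- From a monomial split off k - 1 variables; what remains still has positive degree. The case k =
0 is excluded because the zeroth power of a subspace consists of the constants. -/
theorem isHomogeneous_mem_augmentation_pow {f : MvPolynomial (Fin n) F} {d : ℕ}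
    (hf : f.IsHomogeneous d) : ∀ {k : ℕ}, k ≤ d → 0 < k → f ∈ augmentation F n ^ k := by
  have mono : ∀ (s : Fin n →₀ ℕ) (k : ℕ), k ≤ s.degree → 0 < k →
      (monomial s (1 : F)) ∈ augmentation F n ^ k := by
    intro s k
    induction k generalizing s with
    | zero => intro _ h; exact absurd h (lt_irrefl _)
    | succ k ih =>
      intro hk _
      rcases Nat.eq_zero_or_pos k with rfl | hk0
      · rw [zero_add, pow_one]
        exact isHomogeneous_mem_augmentation (isHomogeneous_monomial 1 rfl) hk
      · obtain ⟨i, hi⟩ : ∃ i, s i ≠ 0 := by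
          by_contra! h
          have : s = 0 := Finsupp.ext h
          simp [this] at hk
        have hle : Finsupp.single i 1 ≤ s := by
          rw [Finsupp.single_le_iff]; omega
        have hs : s = (s - Finsupp.single i 1) + Finsupp.single i 1 :=
          (tsub_add_cancel_of_le hle).symm
        have hdeg : s.degree = (s - Finsupp.single i 1).degree + 1 := by
          conv_lhs => rw [hs, map_add, Finsupp.degree_single]
        rw [hs, ← mul_one (1 : F), ← monomial_mul, pow_succ]
        refine Submodule.mul_mem_mul (ih _ (by omega) hk0) ?_
        exact isHomogeneous_mem_augmentation
          (isHomogeneous_monomial 1 (Finsupp.degree_single i 1)) one_pos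
  intro k hk hk0
  rw [f.as_sum]
  refine Submodule.sum_mem _ fun s hs => ?_
  rw [← mul_one (coeff s f), ← smul_eq_mul, ← smul_monomial]
  refine Submodule.smul_mem _ _ (mono s k ?_ hk0)
  rwa [not_ne_iff.1 (mt hf.coeff_eq_zero (mem_support_iff.1 hs))]

theorem betaModule_le {ρ : Representation F G (Fin n → F)} {k N : ℕ}
    (h : ∀ (d : ℕ) (f : MvPolynomial (Fin n) F), f ∈ invariants ρ → f ∈ augmentation F n →
      f.IsHomogeneous d → N < d → f ∈ posInvariants ρ ^ (k + 1)) :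
    betaModule ρ k ≤ N := by
  refine iSup₂_le fun d ⟨f, hf, hfd, hn⟩ => ?_
  by_contra hlt
  rw [not_le, Nat.cast_lt] at hlt
  rw [mem_posInvariants] at hf
  exact hn (h d f hf.1 hf.2 hfd hlt)

theorem le_betaModule {ρ : Representation F G (Fin n → F)} {k d : ℕ}
    {f : MvPolynomial (Fin n) F} (hf : f ∈ invariants ρ) (hfd : f.IsHomogeneous d) (hd : 0 < d)
    (hn : f ∉ posInvariants ρ ^ (k + 1)) : (d : ℕ∞) ≤ betaModule ρ k :=
  le_iSup₂_of_le (f := fun (d : ℕ) _ => (d : ℕ∞)) d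
    ⟨f, mem_posInvariants.2 ⟨hf, isHomogeneous_mem_augmentation hfd hd⟩, hfd, hn⟩ le_rfl

theorem betaModule_le_beta (ρ : Representation F G (Fin n → F)) (k : ℕ) :
    betaModule ρ k ≤ beta F G k :=
  le_iSup₂_of_le (f := fun (n : ℕ) (ρ : Representation F G (Fin n → F)) => betaModule ρ k)
    n ρ le_rfl

end Action

/-! ### Product-one sequences over the Klein four-group -/

section ZeroSum

theorem KleinFour.mul_self (x : KleinFour) : x * x = 1 := by revert x; decide

/-- There are only three nontrivial elements, so four terms include a trivial one or two equal ones,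
and every element is its own inverse. The weight map lets the terms be group elements or indices of
weight vectors. -/
theorem exists_mul_eq_one_or_card_le_three {α : Type*} (wt : α → KleinFour) (M : Multiset α)
    (hM : 4 ≤ Multiset.card M) :
    ∃ U ≤ M, U ≠ 0 ∧ Multiset.card U ≤ 2 ∧ (U.map wt).prod = 1 := by
  classical
  by_cases h1 : ∃ x ∈ M, wt x = 1
  · obtain ⟨x, hx, hw⟩ := h1
    exact ⟨{x}, Multiset.singleton_le.2 hx, Multiset.singleton_ne_zero x, by simp, by simp [hw]⟩
  push Not at h1
  have hnd : ¬ (M.map wt).Nodup := by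
    intro hnd
    have hle : (⟨M.map wt, hnd⟩ : Finset KleinFour) ⊆ Finset.univ.erase 1 := by
      intro y hy
      obtain ⟨x, hx, rfl⟩ := Multiset.mem_map.1 (Finset.mem_def.1 hy)
      simpa using h1 x hx
    have := Finset.card_le_card hle
    rw [Finset.card_mk, Multiset.card_map] at this
    have h3 : (Finset.univ.erase (1 : KleinFour)).card = 3 := by decide
    omega
  rw [Multiset.nodup_iff_le] at hnd
  push Not at hnd
  obtain ⟨y, hy⟩ := hnd
  obtain ⟨V, hV⟩ := Multiset.le_iff_exists_add.1 hy
  rw [Multiset.cons_add, Multiset.cons_add, Multiset.zero_add] at hV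
  obtain ⟨x, hx, hxy, hV⟩ := (Multiset.map_eq_cons _ _ _ _).2 hV
  obtain ⟨x', hx', hxy', hV⟩ := (Multiset.map_eq_cons _ _ _ _).2 hV
  refine ⟨x ::ₘ {x'}, ?_, Multiset.cons_ne_zero, by simp, ?_⟩
  · rw [← Multiset.cons_erase hx]
    exact Multiset.cons_le_cons _ (Multiset.singleton_le.2 hx')
  · simp [hxy, hxy', KleinFour.mul_self]

/-- Blocks of length one or two are removed k times. Each removal costs at most two terms, so at
least two terms are left; their product is again 1 and they form the last block. -/
theorem exists_zeroSum_decomposition {α : Type*} (wt : α → KleinFour) (k : ℕ) (M : Multiset α)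
    (hM : 2 * k + 2 ≤ Multiset.card M) (hprod : (M.map wt).prod = 1) :
    ∃ A : Multiset (Multiset α), Multiset.card A = k + 1 ∧ A.sum = M ∧
      ∀ U ∈ A, U ≠ 0 ∧ (U.map wt).prod = 1 := by
  classical
  induction k generalizing M with
  | zero =>
    refine ⟨{M}, by simp, by simp, ?_⟩
    simp only [Multiset.mem_singleton, forall_eq]
    refine ⟨?_, hprod⟩
    rintro rfl
    simp at hM
  | succ k ih =>
    obtain ⟨U, hU, hne, hcard, hw⟩ := exists_mul_eq_one_or_card_le_three wt M (by omega)
    obtain ⟨V, rfl⟩ := Multiset.le_iff_exists_add.1 hU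
    rw [Multiset.map_add, Multiset.prod_add, hw, one_mul] at hprod
    rw [Multiset.card_add] at hM
    obtain ⟨A, hA, hs, hall⟩ := ih V (by omega) hprod
    refine ⟨U ::ₘ A, by simp [hA], by simp [hs], ?_⟩
    intro W hWA
    rcases Multiset.mem_cons.1 hWA with rfl | h
    · exact ⟨hne, hw⟩
    · exact hall W h

theorem isProductOne_iff {G : Type*} [CommGroup G] {S : Multiset G} :
    IsProductOne S ↔ S.prod = 1 := by
  constructor
  · rintro ⟨l, rfl, h⟩
    simpa using h
  · intro h
    refine ⟨S.toList, Multiset.coe_toList S, ?_⟩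
    rwa [Multiset.prod_toList]

/-- Every product-one sequence factors into atoms. -/
theorem exists_atoms {G : Type*} [Group G] (S : Multiset G) (hS : IsProductOne S) :
    ∃ A : Multiset (Multiset G), A.sum = S ∧ ∀ U ∈ A, IsMinimalProductOne U := by
  induction h : Multiset.card S using Nat.strong_induction_on generalizing S with
  | _ m ih =>
    by_cases h0 : S = 0
    · exact ⟨0, by simp [h0], by simp⟩
    by_cases hmin : IsMinimalProductOne S
    · exact ⟨{S}, by simp, by simpa using hmin⟩
    have : ∃ A B : Multiset G, IsProductOne A ∧ IsProductOne B ∧ S = A + B ∧ A ≠ 0 ∧ B ≠ 0 := by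
      by_contra! hcon
      refine hmin ⟨hS, h0, fun A B hA hB hAB => ?_⟩
      by_contra! hne
      exact hne.2 (hcon A B hA hB hAB hne.1)
    obtain ⟨A, B, hA, hB, rfl, hA0, hB0⟩ := this
    have hca := Multiset.card_pos.2 hA0
    have hcb := Multiset.card_pos.2 hB0
    rw [Multiset.card_add] at h
    obtain ⟨A', hA', hA''⟩ := ih _ (by omega) A hA rfl
    obtain ⟨B', hB', hB''⟩ := ih _ (by omega) B hB rfl
    refine ⟨A' + B', by simp [hA', hB'], fun U hU => ?_⟩
    rcases Multiset.mem_add.1 hU with h | h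
    exacts [hA'' U h, hB'' U h]

/-- Refining nonempty blocks into atoms cannot decrease their number, so any decomposition bounds
the maximal length of a factorization from below. -/
theorem exists_atoms_of_decomposition {G : Type*} [Group G] (A : Multiset (Multiset G))
    (hA : ∀ U ∈ A, U ≠ 0 ∧ IsProductOne U) :
    ∃ B : Multiset (Multiset G), Multiset.card A ≤ Multiset.card B ∧ B.sum = A.sum ∧
      ∀ U ∈ B, IsMinimalProductOne U := by
  induction A using Multiset.induction_on with
  | empty => exact ⟨0, by simp, by simp, by simp⟩
  | cons U A ih =>
    obtain ⟨B, hcard, hsum, hB⟩ := ih fun V hV => hA V (Multiset.mem_cons_of_mem hV)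
    obtain ⟨hU0, hU⟩ := hA U (Multiset.mem_cons_self U A)
    obtain ⟨C, hC, hC'⟩ := exists_atoms U hU
    have hC0 : 0 < Multiset.card C := by
      rw [Multiset.card_pos]
      rintro rfl
      exact hU0 (by simpa using hC.symm)
    refine ⟨C + B, by simp; omega, by simp [hC, hsum], fun V hV => ?_⟩
    rcases Multiset.mem_add.1 hV with h | h
    exacts [hC' V h, hB V h]

theorem davenport_kleinFour : davenport KleinFour 4 = 9 := by
  apply le_antisymm
  · refine iSup₂_le fun S hS => ?_
    obtain ⟨hS1, hS2⟩ := hS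
    by_contra hlt
    have h10 : 10 ≤ Multiset.card S := by
      have : (9 : ℕ∞) < (Multiset.card S : ℕ∞) := not_le.1 hlt
      exact_mod_cast this
    obtain ⟨A, hA, hs, hall⟩ := exists_zeroSum_decomposition id 4 S (by omega)
      (by simpa using isProductOne_iff.1 hS1)
    obtain ⟨B, hB, hBs, hBa⟩ := exists_atoms_of_decomposition A fun U hU =>
      ⟨(hall U hU).1, isProductOne_iff.2 (by simpa using (hall U hU).2)⟩
    have := hS2 (Multiset.card B) ⟨B, rfl, hBa, by rw [hBs, hs]⟩
    omega
  · let a : KleinFour := (Multiplicative.ofAdd 1, 1)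
    let b : KleinFour := (1, Multiplicative.ofAdd 1)
    -- The extremal sequence: each nontrivial element three times. As 1 does not occur, atoms have
    -- length at least 2, and nine terms leave room for at most four of them.
    let S : Multiset KleinFour :=
      Multiset.replicate 3 a + Multiset.replicate 3 b + Multiset.replicate 3 (a * b)
    have hS : S ∈ {S : Multiset KleinFour | IsProductOne S ∧ ∀ m ∈ lengths S, m ≤ 4} := by
      refine ⟨isProductOne_iff.2 (by decide), ?_⟩
      rintro m ⟨A, rfl, hA, hAS⟩
      have h1 : (1 : KleinFour) ∉ S := by decide
      have h2 : ∀ U ∈ A, 2 ≤ Multiset.card U := by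
        intro U hU
        by_contra hlt
        obtain ⟨hp, h0, -⟩ := hA U hU
        have := Multiset.card_pos.2 h0
        obtain ⟨x, rfl⟩ := Multiset.card_eq_one.1 (show Multiset.card U = 1 by omega)
        rw [isProductOne_iff, Multiset.prod_singleton] at hp
        subst hp
        refine h1 (hAS ▸ ?_)
        exact Multiset.mem_of_le (Multiset.single_le_sum (fun _ _ => Multiset.zero_le _) _ hU)
          (Multiset.mem_singleton_self _)
      have h3 : Multiset.card A.sum = (A.map Multiset.card).sum := by
        rw [← Multiset.cardHom_apply, map_multiset_sum]; rfl
      have h4 : Multiset.card (A.map Multiset.card) • 2 ≤ (A.map Multiset.card).sum := by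
        refine Multiset.card_nsmul_le_sum fun x hx => ?_
        obtain ⟨U, hU, rfl⟩ := Multiset.mem_map.1 hx
        exact h2 U hU
      have h5 : Multiset.card S = 9 := by decide
      rw [hAS, h5, ] at h3
      rw [← h3, Multiset.card_map, smul_eq_mul] at h4
      omega
    exact le_iSup₂_of_le (f := fun (S : Multiset KleinFour) _ => (Multiset.card S : ℕ∞)) S hS
      (by simp [S])

end ZeroSum

/-! ### Decomposing invariants of the Klein four-group -/

section KleinInvariants

/-- The nontrivial character of the group of order two. -/
def signChar (F : Type*) [Field F] : Multiplicative (ZMod 2) →* F where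
  toFun x := if x = 1 then 1 else -1
  map_one' := if_pos rfl
  map_mul' x y := by
    have h : ∀ z : Multiplicative (ZMod 2), z = 1 ∨ z = Multiplicative.ofAdd 1 := by decide
    have h1 : (Multiplicative.ofAdd 1 : Multiplicative (ZMod 2)) ≠ 1 := by decide
    have h2 : (Multiplicative.ofAdd 1 * Multiplicative.ofAdd 1 : Multiplicative (ZMod 2)) = 1 := by
      decide
    rcases h x with rfl | rfl <;> rcases h y with rfl | rfl <;> simp [h1, h2]

theorem signChar_of_ne_one (F : Type*) [Field F] {x : Multiplicative (ZMod 2)} (hx : x ≠ 1) :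
    signChar F x = -1 := if_neg hx

variable {F : Type*} [Field F] {R : Type*} [CommRing R] [Algebra F R]

/-- The elements of `P` fixed by both `a` and `b`. -/
def fixedPart (a b : R →ₐ[F] R) (P : Submodule F R) : Submodule F R where
  carrier := {x | x ∈ P ∧ a x = x ∧ b x = x}
  zero_mem' := ⟨P.zero_mem, map_zero a, map_zero b⟩
  add_mem' := fun {x y} hx hy => ⟨P.add_mem hx.1 hy.1, by rw [map_add, hx.2.1, hy.2.1],
    by rw [map_add, hx.2.2, hy.2.2]⟩
  smul_mem' := fun c x hx => ⟨P.smul_mem c hx.1, by rw [map_smul, hx.2.1],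
    by rw [map_smul, hx.2.2]⟩

theorem multiset_prod_mem {ι : Type*} {P : Submodule F R}
    (hmul : ∀ x ∈ P, ∀ y ∈ P, x * y ∈ P) {f : ι → R} (hf : ∀ i, f i ∈ P) (U : Multiset ι)
    (hU : U ≠ 0) : (U.map f).prod ∈ P := by
  induction U using Multiset.induction_on with
  | empty => exact absurd rfl hU
  | cons i U ih =>
    rw [Multiset.map_cons, Multiset.prod_cons]
    by_cases h : U = 0
    · simpa [h] using hf i
    · exact hmul _ (hf i) _ (ih h)

theorem multiset_prod_mem_pow {Q : Submodule F R} (A : Multiset R) (hA : ∀ x ∈ A, x ∈ Q) :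
    A.prod ∈ Q ^ Multiset.card A := by
  induction A using Multiset.induction_on with
  | empty => 
    rw [Multiset.prod_zero, Multiset.card_zero, pow_zero]
    exact Submodule.mem_one.2 ⟨1, map_one _⟩
  | cons x A ih =>
    rw [Multiset.prod_cons, Multiset.card_cons, pow_succ']
    exact Submodule.mul_mem_mul (hA x (Multiset.mem_cons_self x A))
      (ih fun y hy => hA y (Multiset.mem_cons_of_mem hy))

theorem map_multiset_prod_of_weight {ι M : Type*} [CommMonoid M] (χ : M →* F) (a : R →ₐ[F] R)
    {f : ι → R} {w : ι → M} (h : ∀ i, a (f i) = χ (w i) • f i) (U : Multiset ι) :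
    a (U.map f).prod = χ (U.map w).prod • (U.map f).prod := by
  induction U using Multiset.induction_on with
  | empty => simp
  | cons i U ih =>
    simp only [Multiset.map_cons, Multiset.prod_cons, map_mul, h, ih]
    rw [smul_mul_smul_comm]

theorem multiset_sum_map_prod {ι : Type*} (f : ι → R) (A : Multiset (Multiset ι)) :
    (A.sum.map f).prod = (A.map fun U => (U.map f).prod).prod := by
  induction A using Multiset.induction_on with
  | empty => simp
  | cons U A ih => simp [ih]

/-- Invariants under two commuting involutions of high order in `P` are decomposable. -/
theorem klein_mem_fixedPart_pow (h2 : (2 : F) ≠ 0) {a b : R →ₐ[F] R} (ha : ∀ x, a (a x) = x)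
    (hb : ∀ x, b (b x) = x) (hab : ∀ x, a (b x) = b (a x)) {P : Submodule F R}
    (hmul : ∀ x ∈ P, ∀ y ∈ P, x * y ∈ P) (haP : ∀ x ∈ P, a x ∈ P) (hbP : ∀ x ∈ P, b x ∈ P)
    (k : ℕ) {f : R} (hf : f ∈ P ^ (2 * k + 2)) (haf : a f = f) (hbf : b f = f) :
    f ∈ fixedPart a b P ^ (k + 1) := by
  have h4 : (4 : F) ≠ 0 := by
    rw [show (4 : F) = 2 * 2 by norm_num]; exact mul_ne_zero h2 h2
  let S : Set R := {r | r ∈ P ∧ ∃ w : KleinFour, a r = signChar F w.1 • r ∧ b r = signChar F w.2 • r}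
  have h1 : (Multiplicative.ofAdd 1 : Multiplicative (ZMod 2)) ≠ 1 := by decide
  -- The four summands are four times the projections to the weight spaces of the group generated by
  -- a and b.
  have hS : P ≤ Submodule.span F S := by
    intro r hr
    have key : r = (1 / 4 : F) • ((r + a r + b r + a (b r)) + (r - a r + b r - a (b r)) +
        (r + a r - b r - a (b r)) + (r - a r - b r + a (b r))) := by
      have : ((r + a r + b r + a (b r)) + (r - a r + b r - a (b r)) +
        (r + a r - b r - a (b r)) + (r - a r - b r + a (b r))) = (4 : F) • r := by
        rw [show (4 : F) = 1 + 1 + 1 + 1 by norm_num]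
        simp only [add_smul, one_smul]
        ring
      rw [this, smul_smul, one_div, inv_mul_cancel₀ h4, one_smul]
    rw [key]
    have ar := haP r hr
    have br := hbP r hr
    have abr := haP _ br
    refine Submodule.smul_mem _ _ (Submodule.add_mem _ (Submodule.add_mem _ (Submodule.add_mem _
      (Submodule.subset_span ⟨?_, (1, 1), ?_, ?_⟩)
      (Submodule.subset_span ⟨?_, (Multiplicative.ofAdd 1, 1), ?_, ?_⟩))
      (Submodule.subset_span ⟨?_, (1, Multiplicative.ofAdd 1), ?_, ?_⟩))
      (Submodule.subset_span ⟨?_, (Multiplicative.ofAdd 1, Multiplicative.ofAdd 1), ?_, ?_⟩))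
    · exact P.add_mem (P.add_mem (P.add_mem hr ar) br) abr
    rotate_left 2
    · exact P.sub_mem (P.add_mem (P.sub_mem hr ar) br) abr
    rotate_left 2
    · exact P.sub_mem (P.sub_mem (P.add_mem hr ar) br) abr
    rotate_left 2
    · exact P.add_mem (P.sub_mem (P.sub_mem hr ar) br) abr
    all_goals
      simp only [map_add, map_sub, ha, hb, ← hab, map_one, one_smul, signChar_of_ne_one F h1,
        neg_smul]
      ring
  -- The trace 1 + a + b + ab multiplies a product of weight vectors by 4 if its total weight is
  -- trivial and kills it otherwise. In the first case the product splits into k + 1 invariant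
  -- blocks.
  have key : P ^ (2 * k + 2) ≤ (fixedPart a b P ^ (k + 1)).comap
      (LinearMap.id + a.toLinearMap + b.toLinearMap + a.toLinearMap ∘ₗ b.toLinearMap) := by
    refine (pow_le_pow_left' hS _).trans ?_
    rw [Submodule.span_pow, Submodule.span_le]
    intro x hx
    obtain ⟨g, rfl⟩ := Set.mem_pow.1 hx
    choose hgP w hwa hwb using fun i => (g i).2
    rw [List.prod_ofFn]
    let M : Multiset (Fin (2 * k + 2)) := Finset.univ.val
    let r : Fin (2 * k + 2) → R := fun i => g i
    change (M.map r).prod ∈ _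
    have A : ∀ U : Multiset (Fin (2 * k + 2)), a (U.map r).prod =
        signChar F (U.map w).prod.1 • (U.map r).prod := fun U =>
      map_multiset_prod_of_weight (M := KleinFour) (f := r) (w := w)
        ((signChar F).comp (MonoidHom.fst (Multiplicative (ZMod 2)) (Multiplicative (ZMod 2)))) a hwa U
    have B : ∀ U : Multiset (Fin (2 * k + 2)), b (U.map r).prod =
        signChar F (U.map w).prod.2 • (U.map r).prod := fun U =>
      map_multiset_prod_of_weight (M := KleinFour) (f := r) (w := w)
        ((signChar F).comp (MonoidHom.snd (Multiplicative (ZMod 2)) (Multiplicative (ZMod 2)))) b hwb U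
    change (M.map r).prod + a (M.map r).prod + b (M.map r).prod + a (b (M.map r).prod) ∈
      fixedPart a b P ^ (k + 1)
    by_cases hw : (M.map w).prod = 1
    · obtain ⟨D, hD, hDM, hall⟩ := exists_zeroSum_decomposition w k M (by simp [M]) hw
      have hmem : (M.map r).prod ∈ fixedPart a b P ^ (k + 1) := by
        rw [← hDM, multiset_sum_map_prod, ← hD, ← Multiset.card_map (fun U => (U.map r).prod) D]
        refine multiset_prod_mem_pow _ fun x hx => ?_
        obtain ⟨U, hU, rfl⟩ := Multiset.mem_map.1 hx
        obtain ⟨hU0, hU1⟩ := hall U hU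
        refine ⟨multiset_prod_mem hmul hgP U hU0, ?_, ?_⟩
        · rw [A, hU1]; simp
        · rw [B, hU1]; simp
      have e1 : a (M.map r).prod = (M.map r).prod := by rw [A, hw]; simp
      have e2 : b (M.map r).prod = (M.map r).prod := by rw [B, hw]; simp
      rw [e2, e1]
      exact Submodule.add_mem _ (Submodule.add_mem _ (Submodule.add_mem _ hmem hmem) hmem) hmem
    · have hz : (M.map r).prod + a (M.map r).prod + b (M.map r).prod + a (b (M.map r).prod) = 0 := by
        rw [B, map_smul, A]
        by_cases h : (M.map w).prod.1 = 1
        · have h' : (M.map w).prod.2 ≠ 1 := fun h' => hw (Prod.ext h h')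
          rw [h, signChar_of_ne_one F h', map_one]
          simp
        · rw [signChar_of_ne_one F h]
          simp
      rw [hz]
      exact Submodule.zero_mem _
  -- The trace of the invariant f is 4 f, and 4 is invertible.
  have this : f + a f + b f + a (b f) ∈ fixedPart a b P ^ (k + 1) := key hf
  rw [hbf, haf] at this
  have h := Submodule.smul_mem _ (1 / 4 : F) this
  have e : (1 / 4 : F) • (f + f + f + f) = f := by
    have : f + f + f + f = (4 : F) • f := by
      rw [show (4 : F) = 1 + 1 + 1 + 1 by norm_num]
      simp only [add_smul, one_smul]
    rw [this, smul_smul, one_div, inv_mul_cancel₀ h4, one_smul]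
  rwa [e] at h

end KleinInvariants

/-! ### Decomposing invariants of the symmetric group of degree three -/

section S3Invariants

variable {F : Type*} [Field F] {R : Type*} [CommRing R] [Algebra F R]

/-- An action of the symmetric group of degree three on an algebra by algebra endomorphisms, given
by generators and relations, with a stable subspace closed under multiplication. -/
structure S3Action (c t : R →ₐ[F] R) (P : Submodule F R) : Prop where
  ccc : ∀ x, c (c (c x)) = x
  tt : ∀ x, t (t x) = x
  tc : ∀ x, t (c x) = c (c (t x))
  mul : ∀ x ∈ P, ∀ y ∈ P, x * y ∈ P
  c_mem : ∀ x ∈ P, c x ∈ P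
  t_mem : ∀ x ∈ P, t x ∈ P

variable {c t : R →ₐ[F] R} {P : Submodule F R}

theorem S3Action.c_t (h : S3Action c t P) {x : R} (hx : c x = x) : c (t x) = t x := by
  have := h.tc (c x)
  rw [hx, hx] at this
  have h2 := congrArg c this
  rw [h.ccc] at h2
  exact h2

theorem S3Action.mul_add_mem (h : S3Action c t P) {A : R} (hA : A ∈ P) (cA : c A = A) :
    A + t A ∈ fixedPart c t P :=
  ⟨P.add_mem hA (h.t_mem A hA), by rw [map_add, cA, h.c_t cA], by rw [map_add, h.tt, add_comm]⟩

/-- The relation `tr (A B) ≡ - tr (A · t B)` modulo decomposable invariants. -/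
theorem S3Action.rel (h : S3Action c t P) {A B : R} (hA : A ∈ P) (cA : c A = A) (hB : B ∈ P)
    (cB : c B = B) :
    (A * B + t (A * B)) + (A * t B + t (A * t B)) ∈ fixedPart c t P ^ 2 := by
  have := Submodule.mul_mem_mul (h.mul_add_mem hA cA) (h.mul_add_mem hB cB)
  rw [← pow_two] at this
  convert this using 1
  simp only [map_mul, h.tt]
  ring

theorem mem_of_two_smul_mem (h2 : (2 : F) ≠ 0) {Q : Submodule F R} {x : R} (h : x + x ∈ Q) :
    x ∈ Q := by
  have := Q.smul_mem (2⁻¹ : F) h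
  rwa [← two_smul F x, smul_smul, inv_mul_cancel₀ h2, one_smul] at this

/-- Write tr x = x + t x and work modulo decomposables. Then `S3Action.rel` gives tr(ABD) ≡ -tr(A tB
tD), tr(ABD) ≡ -tr(AB tD) and tr(AB tD) ≡ -tr(A tB tD). Adding the first two and using the third, 2
tr(ABD) ≡ 0. -/
theorem S3Action.three (h : S3Action c t P) (h2 : (2 : F) ≠ 0) {A B D : R} (hA : A ∈ P)
    (cA : c A = A) (hB : B ∈ P) (cB : c B = B) (hD : D ∈ P) (cD : c D = D) :
    A * B * D + t (A * B * D) ∈ fixedPart c t P ^ 2 := by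
  have r1 := h.rel hA cA (h.mul B hB D hD) (by rw [map_mul, cB, cD])
  have r2 := h.rel (h.mul A hA B hB) (by rw [map_mul, cA, cB]) hD cD
  have r3 := h.rel (h.mul A hA _ (h.t_mem D hD)) (by rw [map_mul, cA, h.c_t cD]) hB cB
  refine mem_of_two_smul_mem h2 ?_
  convert Submodule.sub_mem _ (Submodule.add_mem _ r1 r2) r3 using 1
  simp only [map_mul, h.tt]
  ring

/-- This is the weight pattern, up to exchanging ω and ω², that does not split into three
c-invariant blocks. Let A_l be the trace of x₀x₁x₂x₃ · t y with x_l replaced by t x_l. Moving t onto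
x₃ y shows that the trace in question is ≡ -A₃. Since A_k + A_l ≡ 0 for k ≠ l, also 2 A₃ = (A₃ + A₂)
+ (A₃ + A₁) - (A₂ + A₁) ≡ 0. -/
theorem S3Action.four_one (h : S3Action c t P) (h2 : (2 : F) ≠ 0) {ω : F}
    (hω : ω ^ 2 + ω + 1 = 0) {x : Fin 4 → R} {y : R} (hx : ∀ i, x i ∈ P)
    (hcx : ∀ i, c (x i) = ω • x i) (hy : y ∈ P) (hcy : c y = ω ^ 2 • y) :
    x 0 * x 1 * x 2 * (x 3 * y) + t (x 0 * x 1 * x 2 * (x 3 * y)) ∈ fixedPart c t P ^ 2 := by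
  have h3 : ω ^ 3 = 1 := by linear_combination (ω - 1) * hω
  -- As t conjugates c to its inverse, it exchanges the eigenvalues s and s⁻¹ = s².
  have ct : ∀ z : R, ∀ s : F, s ^ 3 = 1 → c z = s • z → c (t z) = s ^ 2 • t z := by
    intro z s hs hz
    have e := congrArg c (h.tc z)
    rw [hz, map_smul, map_smul, h.ccc] at e
    nth_rw 2 [← e]
    rw [smul_smul, ← pow_succ, hs, one_smul]
  have hcx' : ∀ i, c (t (x i)) = ω ^ 2 • t (x i) := fun i => ct _ _ h3 (hcx i)
  have hcy' : c (t y) = ω • t y := by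
    rw [ct _ _ (by rw [← pow_mul, mul_comm, pow_mul, h3, one_pow]) hcy, ← pow_mul,
      show ω ^ (2 * 2) = ω ^ 3 * ω by ring, h3, one_mul]
  have p3 : ∀ u v w : R, c u = ω • u → c v = ω • v → c w = ω • w → c (u * v * w) = u * v * w := by
    intro u v w hu hv hw
    rw [map_mul, map_mul, hu, hv, hw, smul_mul_smul_comm, smul_mul_smul_comm,
      show ω * ω * ω = ω ^ 3 by ring, h3, one_smul]
  have p2 : ∀ u v : R, c u = ω • u → c v = ω ^ 2 • v → c (u * v) = u * v := by
    intro u v hu hv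
    rw [map_mul, hu, hv, smul_mul_smul_comm, show ω * ω ^ 2 = ω ^ 3 by ring, h3, one_smul]
  have m3 : ∀ u v w : R, u ∈ P → v ∈ P → w ∈ P → u * v * w ∈ P := fun u v w hu hv hw =>
    h.mul _ (h.mul _ hu _ hv) _ hw
  have hx' := fun i => h.t_mem _ (hx i)
  have hy' := h.t_mem _ hy
  -- `A i + A j ≡ 0` for the trace `A i` of the product with `x i` replaced by its image
  have key : ∀ i j k l : Fin 4,
      (x i * x j * t y * (x k * t (x l)) + t (x i * x j * t y * (x k * t (x l)))) +
      (x i * x j * t y * (x l * t (x k)) + t (x i * x j * t y * (x l * t (x k)))) ∈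
        fixedPart c t P ^ 2 := by
    intro i j k l
    convert h.rel (m3 _ _ _ (hx i) (hx j) hy') (p3 _ _ _ (hcx i) (hcx j) hcy')
      (h.mul _ (hx k) _ (hx' l)) (p2 _ _ (hcx k) (hcx' l)) using 1
    simp only [map_mul, h.tt]
    ring
  have first := h.rel (m3 _ _ _ (hx 0) (hx 1) (hx 2)) (p3 _ _ _ (hcx 0) (hcx 1) (hcx 2))
      (h.mul _ (hx 3) _ hy) (p2 _ _ (hcx 3) hcy)
  refine mem_of_two_smul_mem h2 ?_
  have k1 := key 0 1 2 3
  have k2 := key 0 2 1 3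
  have k3 := key 0 3 1 2
  convert Submodule.add_mem _ (Submodule.sub_mem _ (Submodule.sub_mem _
    (Submodule.add_mem _ first first) k1) k2) k3 using 1
  simp only [map_mul, h.tt]
  ring


theorem exists_cons_of_card {α : Type*} {M : Multiset α} {k : ℕ} (h : Multiset.card M = k + 1) :
    ∃ a N, M = a ::ₘ N ∧ Multiset.card N = k := by
  obtain ⟨a, ha⟩ := Multiset.card_pos_iff_exists_mem.1 (show 0 < Multiset.card M by omega)
  obtain ⟨N, rfl⟩ := Multiset.exists_cons_of_mem ha
  exact ⟨a, N, rfl, by simpa using h⟩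

/-- The elements of `P` on which `c` acts by the scalar `s`. -/
def eigenPart (c : R →ₐ[F] R) (P : Submodule F R) (s : F) : Set R := {r | r ∈ P ∧ c r = s • r}

theorem exists_eigen_factorization {s₀ s₁ s₂ : F} (m : ℕ) {x : R}
    (hx : x ∈ (eigenPart c P s₀ ∪ eigenPart c P s₁ ∪ eigenPart c P s₂) ^ m) :
    ∃ M₀ M₁ M₂ : Multiset R, x = M₀.prod * M₁.prod * M₂.prod ∧
      Multiset.card M₀ + Multiset.card M₁ + Multiset.card M₂ = m ∧
      (∀ r ∈ M₀, r ∈ eigenPart c P s₀) ∧ (∀ r ∈ M₁, r ∈ eigenPart c P s₁) ∧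
      (∀ r ∈ M₂, r ∈ eigenPart c P s₂) := by
  induction m generalizing x with
  | zero => exact ⟨0, 0, 0, by simpa using hx, by simp⟩
  | succ m ih =>
    rw [pow_succ'] at hx
    obtain ⟨r, hr, y, hy, rfl⟩ := Set.mem_mul.1 hx
    obtain ⟨M₀, M₁, M₂, rfl, hcard, h0, h1, h2⟩ := ih hy
    rcases hr with (hr | hr) | hr
    · refine ⟨r ::ₘ M₀, M₁, M₂, by simp [mul_assoc], by simp; omega, ?_, h1, h2⟩
      simpa using ⟨hr, h0⟩
    · refine ⟨M₀, r ::ₘ M₁, M₂, by simp; ring, by simp; omega, h0, ?_, h2⟩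
      simpa using ⟨hr, h1⟩
    · refine ⟨M₀, M₁, r ::ₘ M₂, by simp; ring, by simp; omega, h0, h1, ?_⟩
      simpa using ⟨hr, h2⟩

theorem map_multiset_prod_of_eigen {s : F} {M : Multiset R} (h : ∀ r ∈ M, r ∈ eigenPart c P s) :
    c M.prod = s ^ Multiset.card M • M.prod := by
  induction M using Multiset.induction_on with
  | empty => simp
  | cons r M ih =>
    rw [Multiset.prod_cons, map_mul, (h r (Multiset.mem_cons_self r M)).2,
      ih fun x hx => h x (Multiset.mem_cons_of_mem hx), smul_mul_smul_comm, Multiset.card_cons,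
      pow_succ']

/-- A zero-sum sequence of length five over the cyclic group of order three splits into three
zero-sum blocks, unless one nontrivial weight occurs four times and the other once. -/
theorem S3Action.trace_mem (h : S3Action c t P) (h2 : (2 : F) ≠ 0) {ω : F}
    (hω : ω ^ 2 + ω + 1 = 0) {M₀ M₁ M₂ : Multiset R}
    (hcard : Multiset.card M₀ + Multiset.card M₁ + Multiset.card M₂ = 5)
    (hsum : (Multiset.card M₁ + 2 * Multiset.card M₂) % 3 = 0)
    (H0 : ∀ r ∈ M₀, r ∈ eigenPart c P 1) (H1 : ∀ r ∈ M₁, r ∈ eigenPart c P ω)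
    (H2 : ∀ r ∈ M₂, r ∈ eigenPart c P (ω ^ 2)) :
    M₀.prod * M₁.prod * M₂.prod + t (M₀.prod * M₁.prod * M₂.prod) ∈ fixedPart c t P ^ 2 := by
  have hω3 : ω ^ 3 = 1 := by linear_combination (ω - 1) * hω
  have hω6 : ω ^ 6 = 1 := by rw [show ω ^ 6 = (ω ^ 3) ^ 2 by ring, hω3, one_pow]
  have hω' : (ω ^ 2) ^ 2 + ω ^ 2 + 1 = 0 := by linear_combination (ω ^ 2 - ω + 1) * hω
  -- zero-sum products
  have z1 : ∀ u ∈ eigenPart c P 1, u ∈ P ∧ c u = u := fun u hu => by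
    simpa [eigenPart] using hu
  have z12 : ∀ u ∈ eigenPart c P ω, ∀ v ∈ eigenPart c P (ω ^ 2), u * v ∈ P ∧ c (u * v) = u * v := by
    rintro u ⟨hu, cu⟩ v ⟨hv, cv⟩
    refine ⟨h.mul _ hu _ hv, ?_⟩
    rw [map_mul, cu, cv, smul_mul_smul_comm, show ω * ω ^ 2 = ω ^ 3 by ring, hω3, one_smul]
  have zz : ∀ u v, (u ∈ P ∧ c u = u) → (v ∈ P ∧ c v = v) → u * v ∈ P ∧ c (u * v) = u * v := by
    rintro u v ⟨hu, cu⟩ ⟨hv, cv⟩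
    exact ⟨h.mul _ hu _ hv, by rw [map_mul, cu, cv]⟩
  have z3 : ∀ s : F, s ^ 3 = 1 → ∀ u ∈ eigenPart c P s, ∀ v ∈ eigenPart c P s,
      ∀ w ∈ eigenPart c P s, u * v * w ∈ P ∧ c (u * v * w) = u * v * w := by
    rintro s hs u ⟨hu, cu⟩ v ⟨hv, cv⟩ w ⟨hw, cw⟩
    refine ⟨h.mul _ (h.mul _ hu _ hv) _ hw, ?_⟩
    rw [map_mul, map_mul, cu, cv, cw, smul_mul_smul_comm, smul_mul_smul_comm,
      show s * s * s = s ^ 3 by ring, hs, one_smul]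
  have three : ∀ u v w x, (u ∈ P ∧ c u = u) → (v ∈ P ∧ c v = v) → (w ∈ P ∧ c w = w) →
      x = u * v * w → x + t x ∈ fixedPart c t P ^ 2 := by
    rintro u v w x ⟨hu, cu⟩ ⟨hv, cv⟩ ⟨hw, cw⟩ rfl
    exact h.three h2 hu cu hv cv hw cw
  -- All solutions of n₀ + n₁ + n₂ = 5 with n₁ + 2 n₂ divisible by 3. The sums 3 + 1 and 3 + 1 + 1
  -- stay unevaluated to match `exists_cons_of_card`.
  have hcases : (Multiset.card M₀ = 3 + 1 + 1 ∧ Multiset.card M₁ = 0 ∧ Multiset.card M₂ = 0) ∨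
      (Multiset.card M₀ = 3 ∧ Multiset.card M₁ = 1 ∧ Multiset.card M₂ = 1) ∨
      (Multiset.card M₀ = 2 ∧ Multiset.card M₁ = 3 ∧ Multiset.card M₂ = 0) ∨
      (Multiset.card M₀ = 2 ∧ Multiset.card M₁ = 0 ∧ Multiset.card M₂ = 3) ∨
      (Multiset.card M₀ = 1 ∧ Multiset.card M₁ = 2 ∧ Multiset.card M₂ = 2) ∨
      (Multiset.card M₀ = 0 ∧ Multiset.card M₁ = 3 + 1 ∧ Multiset.card M₂ = 1) ∨
      (Multiset.card M₀ = 0 ∧ Multiset.card M₁ = 1 ∧ Multiset.card M₂ = 3 + 1) := by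
    clear H0 H1 H2
    generalize Multiset.card M₀ = n₀ at *
    generalize Multiset.card M₁ = n₁ at *
    generalize Multiset.card M₂ = n₂ at *
    have : n₁ ≤ 5 := by omega
    interval_cases n₁ <;> omega
  rcases hcases with ⟨c0, c1, c2⟩ | ⟨c0, c1, c2⟩ | ⟨c0, c1, c2⟩ | ⟨c0, c1, c2⟩ | ⟨c0, c1, c2⟩ |
    ⟨c0, c1, c2⟩ | ⟨c0, c1, c2⟩
  · obtain rfl := Multiset.card_eq_zero.1 c1
    obtain rfl := Multiset.card_eq_zero.1 c2
    obtain ⟨a, M, rfl, hM⟩ := exists_cons_of_card c0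
    obtain ⟨d, N, rfl, hN⟩ := exists_cons_of_card hM
    obtain ⟨e, f, g, rfl⟩ := Multiset.card_eq_three.1 hN
    refine three a d (e * f * g) _ (z1 _ (H0 _ (by simp))) (z1 _ (H0 _ (by simp)))
      (zz _ _ (zz _ _ (z1 _ (H0 _ (by simp))) (z1 _ (H0 _ (by simp)))) (z1 _ (H0 _ (by simp)))) ?_
    simp [mul_assoc]
  · obtain ⟨u, v, w, rfl⟩ := Multiset.card_eq_three.1 c0
    obtain ⟨x, rfl⟩ := Multiset.card_eq_one.1 c1
    obtain ⟨y, rfl⟩ := Multiset.card_eq_one.1 c2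
    refine three u (v * w) (x * y) _ (z1 _ (H0 _ (by simp)))
      (zz _ _ (z1 _ (H0 _ (by simp))) (z1 _ (H0 _ (by simp))))
      (z12 _ (H1 _ (by simp)) _ (H2 _ (by simp))) ?_
    simp [mul_assoc]
  · obtain ⟨u, v, rfl⟩ := Multiset.card_eq_two.1 c0
    obtain ⟨x, y, z, rfl⟩ := Multiset.card_eq_three.1 c1
    obtain rfl := Multiset.card_eq_zero.1 c2
    refine three u v (x * y * z) _ (z1 _ (H0 _ (by simp))) (z1 _ (H0 _ (by simp)))
      (z3 ω hω3 _ (H1 _ (by simp)) _ (H1 _ (by simp)) _ (H1 _ (by simp))) ?_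
    simp [mul_assoc]
  · obtain ⟨u, v, rfl⟩ := Multiset.card_eq_two.1 c0
    obtain ⟨x, y, z, rfl⟩ := Multiset.card_eq_three.1 c2
    obtain rfl := Multiset.card_eq_zero.1 c1
    refine three u v (x * y * z) _ (z1 _ (H0 _ (by simp))) (z1 _ (H0 _ (by simp)))
      (z3 (ω ^ 2) (by rw [← pow_mul]; exact hω6) _ (H2 _ (by simp)) _ (H2 _ (by simp)) _
        (H2 _ (by simp))) ?_
    simp [mul_assoc]
  · obtain ⟨u, rfl⟩ := Multiset.card_eq_one.1 c0
    obtain ⟨v, w, rfl⟩ := Multiset.card_eq_two.1 c1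
    obtain ⟨x, y, rfl⟩ := Multiset.card_eq_two.1 c2
    refine three u (v * x) (w * y) _ (z1 _ (H0 _ (by simp)))
      (z12 _ (H1 _ (by simp)) _ (H2 _ (by simp))) (z12 _ (H1 _ (by simp)) _ (H2 _ (by simp))) ?_
    simp only [Multiset.prod_singleton, Multiset.insert_eq_cons, Multiset.prod_cons]
    ring
  · obtain rfl := Multiset.card_eq_zero.1 c0
    obtain ⟨a, M, rfl, hM⟩ := exists_cons_of_card c1
    obtain ⟨d, e, f, rfl⟩ := Multiset.card_eq_three.1 hM
    obtain ⟨y, rfl⟩ := Multiset.card_eq_one.1 c2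
    have H : ∀ i, (![a, d, e, f] : Fin 4 → R) i ∈ eigenPart c P ω := by
      intro i
      fin_cases i <;> exact H1 _ (by simp)
    convert h.four_one h2 hω (fun i => (H i).1) (fun i => (H i).2) (H2 y (by simp)).1
      (H2 y (by simp)).2 using 1
    simp [mul_assoc]
  · obtain rfl := Multiset.card_eq_zero.1 c0
    obtain ⟨a, M, rfl, hM⟩ := exists_cons_of_card c2
    obtain ⟨d, e, f, rfl⟩ := Multiset.card_eq_three.1 hM
    obtain ⟨y, rfl⟩ := Multiset.card_eq_one.1 c1
    have H : ∀ i, (![a, d, e, f] : Fin 4 → R) i ∈ eigenPart c P (ω ^ 2) := by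
      intro i
      fin_cases i <;> exact H2 _ (by simp)
    convert h.four_one h2 hω' (fun i => (H i).1) (fun i => (H i).2) (H1 y (by simp)).1
      (show c y = ((ω ^ 2) ^ 2) • y by
        rw [(H1 y (by simp)).2, ← pow_mul, show ω ^ (2 * 2) = ω ^ 3 * ω by ring, hω3, one_mul])
      using 1
    simp only [Multiset.prod_zero, Multiset.insert_eq_cons, Multiset.prod_cons,
      Multiset.prod_singleton, Matrix.cons_val]
    ring_nf

/-- The trace (1 + t)(1 + c + c²) multiplies x by 6. On a product of five eigenvectors of c the
factor 1 + c + c² is 3 or 0 according to the total weight, and in the first case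
`S3Action.trace_mem` applies. -/
theorem S3Action.mem_fixedPart_sq_of_root (h : S3Action c t P) (h2 : (2 : F) ≠ 0) (h3 : (3 : F) ≠ 0)
    {ω : F} (hω : ω ^ 2 + ω + 1 = 0) {x : R} (hx : x ∈ P ^ 5) (cx : c x = x) (tx : t x = x) :
    x ∈ fixedPart c t P ^ 2 := by
  have hω3 : ω ^ 3 = 1 := by linear_combination (ω - 1) * hω
  have hS : P ≤ Submodule.span F (eigenPart c P 1 ∪ eigenPart c P ω ∪ eigenPart c P (ω ^ 2)) := by
    intro r hr
    have cr := h.c_mem r hr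
    have ccr := h.c_mem _ cr
    have key : r = (1 / 3 : F) • ((r + c r + c (c r)) + (r + ω ^ 2 • c r + ω • c (c r)) +
        (r + ω • c r + ω ^ 2 • c (c r))) := by
      have : (r + c r + c (c r)) + (r + ω ^ 2 • c r + ω • c (c r)) +
        (r + ω • c r + ω ^ 2 • c (c r)) = (3 : F) • r + (ω ^ 2 + ω + 1) • (c r + c (c r)) := by
        rw [show (3 : F) = 1 + 1 + 1 by norm_num]
        simp only [add_smul, one_smul, smul_add]
        abel
      rw [this, hω, zero_smul, add_zero, smul_smul, one_div, inv_mul_cancel₀ h3, one_smul]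
    rw [key]
    refine Submodule.smul_mem _ _ (Submodule.add_mem _ (Submodule.add_mem _
      (Submodule.subset_span (Or.inl (Or.inl ⟨P.add_mem (P.add_mem hr cr) ccr, ?_⟩)))
      (Submodule.subset_span (Or.inl (Or.inr
        ⟨P.add_mem (P.add_mem hr (P.smul_mem _ cr)) (P.smul_mem _ ccr), ?_⟩))))
      (Submodule.subset_span (Or.inr
        ⟨P.add_mem (P.add_mem hr (P.smul_mem _ cr)) (P.smul_mem _ ccr), ?_⟩)))
    · simp only [map_add, h.ccc, one_smul]
      abel
    · simp only [map_add, map_smul, h.ccc, smul_add, smul_smul]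
      rw [show ω * ω ^ 2 = 1 by rw [← hω3]; ring, show ω * ω = ω ^ 2 by ring]
      simp only [one_smul]
      abel
    · simp only [map_add, map_smul, h.ccc, smul_add, smul_smul]
      rw [show ω ^ 2 * ω = 1 by rw [← hω3]; ring, show ω ^ 2 * ω ^ 2 = ω by
        rw [show ω ^ 2 * ω ^ 2 = ω ^ 3 * ω by ring, hω3, one_mul]]
      simp only [one_smul]
      abel
  have key : P ^ 5 ≤ (fixedPart c t P ^ 2).comap ((LinearMap.id + t.toLinearMap) ∘ₗ
      (LinearMap.id + c.toLinearMap + c.toLinearMap ∘ₗ c.toLinearMap)) := by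
    refine (pow_le_pow_left' hS _).trans ?_
    rw [Submodule.span_pow, Submodule.span_le]
    intro y hy
    obtain ⟨M₀, M₁, M₂, rfl, hcard, H0, H1, H2⟩ := exists_eigen_factorization 5 hy
    set y := M₀.prod * M₁.prod * M₂.prod with hydef
    have hc : c y = ω ^ (Multiset.card M₁ + 2 * Multiset.card M₂) • y := by
      rw [hydef, map_mul, map_mul, map_multiset_prod_of_eigen H0, map_multiset_prod_of_eigen H1,
        map_multiset_prod_of_eigen H2, smul_mul_smul_comm, smul_mul_smul_comm, one_pow, one_mul,
        ← pow_mul, ← pow_add]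
    change (y + c y + c (c y)) + t (y + c y + c (c y)) ∈ fixedPart c t P ^ 2
    rw [← Nat.div_add_mod (Multiset.card M₁ + 2 * Multiset.card M₂) 3, pow_add, pow_mul, hω3,
      one_pow, one_mul] at hc
    have hlt := Nat.mod_lt (Multiset.card M₁ + 2 * Multiset.card M₂) (show 3 > 0 by norm_num)
    by_cases h0 : (Multiset.card M₁ + 2 * Multiset.card M₂) % 3 = 0
    · have hm := h.trace_mem h2 hω hcard h0 H0 H1 H2
      rw [h0, pow_zero, one_smul] at hc
      rw [hc, hc, map_add, map_add]
      convert Submodule.add_mem _ (Submodule.add_mem _ hm hm) hm using 1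
      rw [← hydef]
      abel
    · have hz : y + c y + c (c y) = 0 := by
        rw [hc, map_smul, hc, smul_smul, ← pow_add]
        nth_rw 1 [← one_smul F y]
        rw [← add_smul, ← add_smul]
        obtain h1 | h1 : (Multiset.card M₁ + 2 * Multiset.card M₂) % 3 = 1 ∨
          (Multiset.card M₁ + 2 * Multiset.card M₂) % 3 = 2 := by omega
        · rw [h1, show (1 : F) + ω ^ 1 + ω ^ (1 + 1) = 0 by linear_combination hω, zero_smul]
        · rw [h1, show (1 : F) + ω ^ 2 + ω ^ (2 + 2) = 0 by
            linear_combination (ω ^ 2 - ω + 1) * hω, zero_smul]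
      rw [hz, map_zero, add_zero]
      exact Submodule.zero_mem _
  have hm : (x + c x + c (c x)) + t (x + c x + c (c x)) ∈ fixedPart c t P ^ 2 := key hx
  rw [cx, cx, map_add, map_add, tx] at hm
  have hm' := mem_of_two_smul_mem h2 hm
  have := Submodule.smul_mem _ (3⁻¹ : F) hm'
  rwa [show x + x + x = (3 : F) • x by
    rw [show (3 : F) = 1 + 1 + 1 by norm_num]; simp only [add_smul, one_smul], smul_smul,
    inv_mul_cancel₀ h3, one_smul] at this

end S3Invariants

/-! ### Adjoining a cube root of unity and descending again -/

section BaseChange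

variable {F : Type*} [Field F] {R : Type*} [CommRing R] [Algebra F R] {c t : R →ₐ[F] R}
  {P : Submodule F R} (K : Type*) [Field K] [Algebra F K]

/-- The extension of scalars of an algebra endomorphism. -/
abbrev extendHom (a : R →ₐ[F] R) : K ⊗[F] R →ₐ[K] K ⊗[F] R :=
  Algebra.TensorProduct.map (AlgHom.id K K) a

theorem baseChange_mul_mem {A B D : Submodule F R} (h : ∀ x ∈ A, ∀ y ∈ B, x * y ∈ D)
    {x y : K ⊗[F] R} (hx : x ∈ A.baseChange K) (hy : y ∈ B.baseChange K) :
    x * y ∈ D.baseChange K := by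
  have : A.baseChange K * B.baseChange K ≤ D.baseChange K := by
    rw [Submodule.baseChange_eq_span, Submodule.baseChange_eq_span, Submodule.span_mul_span,
      Submodule.span_le]
    rintro _ ⟨_, ⟨a, ha, rfl⟩, _, ⟨b, hb, rfl⟩, rfl⟩
    simpa using Submodule.tmul_mem_baseChange_of_mem (1 : K) (h a ha b hb)
  exact this (Submodule.mul_mem_mul hx hy)

theorem baseChange_map_mem {A B : Submodule F R} {f : R →ₗ[F] R} (h : ∀ x ∈ A, f x ∈ B)
    {x : K ⊗[F] R} (hx : x ∈ A.baseChange K) : f.baseChange K x ∈ B.baseChange K := by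
  have : A.baseChange K ≤ (B.baseChange K).comap (f.baseChange K) := by
    conv_lhs => rw [Submodule.baseChange_eq_span]
    rw [Submodule.span_le]
    rintro _ ⟨a, ha, rfl⟩
    simpa using Submodule.tmul_mem_baseChange_of_mem (1 : K) (h a ha)
  exact this hx

theorem one_tmul_mem_baseChange_pow {x : R} {m : ℕ} (hx : x ∈ P ^ m) :
    (1 : K) ⊗ₜ[F] x ∈ P.baseChange K ^ m := by
  induction m generalizing x with
  | zero =>
    rw [pow_zero] at hx ⊢
    obtain ⟨r, rfl⟩ := Submodule.mem_one.1 hx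
    refine Submodule.mem_one.2 ⟨algebraMap F K r, ?_⟩
    rw [Algebra.TensorProduct.algebraMap_apply, Algebra.algebraMap_self_apply,
      Algebra.algebraMap_eq_smul_one r, Algebra.algebraMap_eq_smul_one r,
      ← TensorProduct.smul_tmul', TensorProduct.tmul_smul]
  | succ m ih =>
    rw [pow_succ] at hx ⊢
    refine Submodule.mul_induction_on hx (fun a ha b hb => ?_) fun a b ha hb => ?_
    · have := Submodule.mul_mem_mul (ih ha) (Submodule.tmul_mem_baseChange_of_mem (1 : K) hb)
      simpa using this
    · rw [TensorProduct.tmul_add]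
      exact Submodule.add_mem _ ha hb

/-- An F-linear retraction of K onto F, tensored with R, sends the extension of Q into Q and 1 ⊗ x
to x. -/
theorem mem_of_one_tmul_mem_baseChange {Q : Submodule F R} {x : R}
    (hx : (1 : K) ⊗ₜ[F] x ∈ Q.baseChange K) : x ∈ Q := by
  obtain ⟨l, hl⟩ := LinearMap.exists_leftInverse_of_injective (Algebra.linearMap F K)
    (LinearMap.ker_eq_bot.2 (algebraMap F K).injective)
  have hl1 : l 1 = 1 := by
    have := DFunLike.congr_fun hl 1
    simpa using this
  let L : K ⊗[F] R →ₗ[F] R := (TensorProduct.lid F R).toLinearMap ∘ₗ LinearMap.rTensor R l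
  have key : ∀ y ∈ Q.baseChange K, L y ∈ Q := by
    intro y hy
    rw [Submodule.baseChange_eq_span] at hy
    -- The span is over K but L is only F-linear, so the induction carries an arbitrary scalar of K.
    refine Submodule.span_induction (p := fun y _ => ∀ k : K, L (k • y) ∈ Q) ?_ ?_ ?_ ?_ hy 1
      |> fun h => by simpa using h
    · rintro _ ⟨a, ha, rfl⟩ k
      simpa [L, TensorProduct.smul_tmul'] using Q.smul_mem (l k) ha
    · intro k
      simp
    · intro a b _ _ ha hb k
      rw [smul_add, map_add]
      exact Q.add_mem (ha k) (hb k)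
    · intro s a _ ha k
      rw [smul_smul]
      exact ha _
  have := key _ hx
  simpa [L, hl1] using this

theorem S3Action.baseChange (h : S3Action c t P) :
    S3Action (extendHom K c) (extendHom K t) (P.baseChange K) where
  ccc x := by
    have : ((extendHom K c).comp ((extendHom K c).comp (extendHom K c))) = AlgHom.id K _ := by
      ext x; simp [h.ccc]
    exact DFunLike.congr_fun this x
  tt x := by
    have : ((extendHom K t).comp (extendHom K t)) = AlgHom.id K _ := by
      ext x; simp [h.tt]
    exact DFunLike.congr_fun this x
  tc x := by
    have : (extendHom K t).comp (extendHom K c) =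
        (extendHom K c).comp ((extendHom K c).comp (extendHom K t)) := by
      ext x; simp [h.tc]
    exact DFunLike.congr_fun this x
  mul _ hx _ hy := baseChange_mul_mem K h.mul hx hy
  c_mem _ hx := baseChange_map_mem K (f := c.toLinearMap) h.c_mem hx
  t_mem _ hx := baseChange_map_mem K (f := t.toLinearMap) h.t_mem hx

theorem S3Action.trace_mem_fixedPart (h : S3Action c t P) {x : R} (hx : x ∈ P) :
    x + c x + c (c x) + t (x + c x + c (c x)) ∈ fixedPart c t P := by
  have cx := h.c_mem x hx
  refine h.mul_add_mem (P.add_mem (P.add_mem hx cx) (h.c_mem _ cx)) ?_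
  rw [map_add, map_add, h.ccc]
  abel

/-- A fixed vector is one sixth of its trace, and the trace is the extension of an F-linear map from
P into its fixed part. -/
theorem S3Action.fixedPart_baseChange_le (h : S3Action c t P) (h2 : (2 : F) ≠ 0)
    (h3 : (3 : F) ≠ 0) :
    fixedPart (extendHom K c) (extendHom K t) (P.baseChange K) ≤
      (fixedPart c t P).baseChange K := by
  rintro x ⟨hx, cx, tx⟩
  let f : R →ₗ[F] R := LinearMap.id + c.toLinearMap + c.toLinearMap ∘ₗ c.toLinearMap +
    t.toLinearMap ∘ₗ (LinearMap.id + c.toLinearMap + c.toLinearMap ∘ₗ c.toLinearMap)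
  have hm := baseChange_map_mem K (f := f) (fun x hx => h.trace_mem_fixedPart hx) hx
  have hf : f.baseChange K x = x + extendHom K c x + extendHom K c (extendHom K c x) +
      extendHom K t (x + extendHom K c x + extendHom K c (extendHom K c x)) := by
    simp only [f, LinearMap.baseChange_add, LinearMap.baseChange_comp, LinearMap.baseChange_id]
    rfl
  rw [hf, cx, cx, map_add, map_add, tx] at hm
  have h6 : (6 : K) ≠ 0 := by
    have : (6 : F) ≠ 0 := by
      rw [show (6 : F) = 2 * 3 by norm_num]; exact mul_ne_zero h2 h3
    rw [← map_ofNat (algebraMap F K) 6]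
    simpa using this
  have := Submodule.smul_mem _ (6⁻¹ : K) hm
  rwa [show x + x + x + (x + x + x) = (6 : K) • x by
    rw [show (6 : K) = 1 + 1 + 1 + (1 + 1 + 1) by norm_num]; simp only [add_smul, one_smul],
    smul_smul, inv_mul_cancel₀ h6, one_smul] at this

/-- Invariants of the symmetric group of degree three that lie in the fifth power of a stable
subspace closed under multiplication are decomposable. -/
theorem S3Action.mem_fixedPart_sq (h : S3Action c t P) (h2 : (2 : F) ≠ 0) (h3 : (3 : F) ≠ 0)
    {x : R} (hx : x ∈ P ^ 5) (cx : c x = x) (tx : t x = x) : x ∈ fixedPart c t P ^ 2 := by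
  -- Over K there is a root of ω² + ω + 1. Invariants over K are K-combinations of invariants over
  -- F, so the decomposition found there descends.
  let K := AlgebraicClosure F
  obtain ⟨ω, hω⟩ : ∃ ω : K, ω ^ 2 + ω + 1 = 0 := by
    have hd : (Polynomial.X ^ 2 + Polynomial.X + 1 : Polynomial K).degree ≠ 0 := by
      have : (Polynomial.X ^ 2 + Polynomial.X + 1 : Polynomial K).degree = 2 := by compute_degree!
      rw [this]; decide
    obtain ⟨ω, hω⟩ := IsAlgClosed.exists_root _ hd
    exact ⟨ω, by simpa [Polynomial.IsRoot] using hω⟩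
  have k2 : (2 : K) ≠ 0 := by
    rw [← map_ofNat (algebraMap F K) 2]; simpa using h2
  have k3 : (3 : K) ≠ 0 := by
    rw [← map_ofNat (algebraMap F K) 3]; simpa using h3
  have hm := (h.baseChange K).mem_fixedPart_sq_of_root k2 k3 hω
    (one_tmul_mem_baseChange_pow K hx) (by simp [cx]) (by simp [tx])
  refine mem_of_one_tmul_mem_baseChange K ?_
  have hle := h.fixedPart_baseChange_le K h2 h3
  have := pow_le_pow_left' hle 2 hm
  rw [pow_two] at this
  refine Submodule.mul_le.2 (fun a ha b hb => baseChange_mul_mem K (fun u hu v hv => ?_) ha hb) this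
  rw [pow_two]
  exact Submodule.mul_mem_mul hu hv

end BaseChange

/-! ### Upper bounds for the three Noether numbers -/

section UpperBounds

variable {F : Type*} [Field F] {G : Type*} [Group G] {n : ℕ}

theorem two_ne_zero_and_three_ne_zero (hF : ¬ ringChar F ∣ Nat.card S4) :
    (2 : F) ≠ 0 ∧ (3 : F) ≠ 0 := by
  have hcard : Nat.card S4 = 24 := by
    rw [Nat.card_eq_fintype_card, Fintype.card_perm, Fintype.card_fin]; rfl
  rw [hcard] at hF
  constructor
  · intro h
    have h2 : ((2 : ℕ) : F) = 0 := by exact_mod_cast h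
    exact hF (((ringChar.spec F 2).1 h2).trans (by norm_num))
  · intro h
    have h3 : ((3 : ℕ) : F) = 0 := by exact_mod_cast h
    exact hF (((ringChar.spec F 3).1 h3).trans (by norm_num))

theorem mem_pow_of_forall_mem {A : Type*} [CommRing A] [Algebra F A] {P Q : Submodule F A} {m : ℕ}
    {x : A} (hx : x ∈ P ^ m) (h : ∀ x ∈ P, x ∈ Q) : x ∈ Q ^ m :=
  pow_le_pow_left' (show P ≤ Q from h) m hx

theorem polyAct_fixed_mul {ρ : Representation F G (Fin n → F)} {f : MvPolynomial (Fin n) F}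
    {g h : G} (hg : polyAct ρ g f = f) (hh : polyAct ρ h f = f) : polyAct ρ (g * h) f = f := by
  rw [polyAct_mul, hh, hg]

theorem polyAct_fixed_pow {ρ : Representation F G (Fin n → F)} {f : MvPolynomial (Fin n) F}
    {g : G} (hg : polyAct ρ g f = f) (m : ℕ) : polyAct ρ (g ^ m) f = f := by
  induction m with
  | zero => rw [pow_zero, polyAct_one]
  | succ m ih => rw [pow_succ, polyAct_fixed_mul ih hg]

theorem polyAct_polyAct_of_mul_eq_one (ρ : Representation F G (Fin n → F)) {g : G}
    (hg : g * g = 1) (x : MvPolynomial (Fin n) F) : polyAct ρ g (polyAct ρ g x) = x := by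
  rw [← polyAct_mul, hg, polyAct_one]

theorem betaModule_kleinFour_le (h2 : (2 : F) ≠ 0) (ρ : Representation F KleinFour (Fin n → F)) :
    betaModule ρ 4 ≤ 9 := by
  refine betaModule_le (N := 9) fun d f hf h0 hfd hd => ?_
  let a : KleinFour := (Multiplicative.ofAdd 1, 1)
  let b : KleinFour := (1, Multiplicative.ofAdd 1)
  have hm := klein_mem_fixedPart_pow h2 (a := polyAct ρ a) (b := polyAct ρ b)
    (polyAct_polyAct_of_mul_eq_one ρ (by decide)) (polyAct_polyAct_of_mul_eq_one ρ (by decide))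
    (fun x => by rw [← polyAct_mul, ← polyAct_mul, mul_comm])
    (P := augmentation F n) (fun x hx y _ => augmentation_mul hx)
    (fun x hx => polyAct_mem_augmentation ρ a hx) (fun x hx => polyAct_mem_augmentation ρ b hx) 4
    (isHomogeneous_mem_augmentation_pow hfd (by omega) (by omega)) (hf a) (hf b)
  refine mem_pow_of_forall_mem hm fun x hx => ?_
  obtain ⟨hx0, ha, hb⟩ := hx
  refine mem_posInvariants.2 ⟨fun g => ?_, hx0⟩
  have hg : ∀ g : KleinFour, ∃ i : Fin 2, ∃ j : Fin 2, g = a ^ (i : ℕ) * b ^ (j : ℕ) := by decide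
  obtain ⟨i, j, rfl⟩ := hg g
  exact polyAct_fixed_mul (polyAct_fixed_pow ha _) (polyAct_fixed_pow hb _)

theorem betaModule_dihedral_le (h2 : (2 : F) ≠ 0) (h3 : (3 : F) ≠ 0)
    (ρ : Representation F (DihedralGroup 3) (Fin n → F)) : betaModule ρ 1 ≤ 4 := by
  refine betaModule_le (N := 4) fun d f hf h0 hfd hd => ?_
  let c : DihedralGroup 3 := .r 1
  let t : DihedralGroup 3 := .sr 0
  have hS : S3Action (polyAct ρ c) (polyAct ρ t) (augmentation F n) :=
    { ccc := fun x => by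
        rw [← polyAct_mul, ← polyAct_mul, show c * c * c = 1 by decide, polyAct_one]
      tt := polyAct_polyAct_of_mul_eq_one ρ (by decide)
      tc := fun x => by
        rw [← polyAct_mul, ← polyAct_mul, ← polyAct_mul, show t * c = c * c * t by decide]
      mul := fun x hx y _ => augmentation_mul hx
      c_mem := fun x hx => polyAct_mem_augmentation ρ c hx
      t_mem := fun x hx => polyAct_mem_augmentation ρ t hx }
  have hm := hS.mem_fixedPart_sq h2 h3
    (isHomogeneous_mem_augmentation_pow hfd (by omega) (by omega)) (hf c) (hf t)
  refine mem_pow_of_forall_mem hm fun x hx => ?_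
  obtain ⟨hx0, hc, ht⟩ := hx
  refine mem_posInvariants.2 ⟨fun g => ?_, hx0⟩
  have hg : ∀ g : DihedralGroup 3, ∃ i : Fin 3, ∃ j : Fin 2, g = c ^ (i : ℕ) * t ^ (j : ℕ) := by
    decide
  obtain ⟨i, j, rfl⟩ := hg g
  exact polyAct_fixed_mul (polyAct_fixed_pow hc _) (polyAct_fixed_pow ht _)

theorem betaModule_S4_le (h2 : (2 : F) ≠ 0) (h3 : (3 : F) ≠ 0)
    (ρ : Representation F S4 (Fin n → F)) : betaModule ρ 1 ≤ 9 := by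
  refine betaModule_le (N := 9) fun d f hf h0 hfd hd => ?_
  let a : S4 := Equiv.swap 0 1 * Equiv.swap 2 3
  let b : S4 := Equiv.swap 0 2 * Equiv.swap 1 3
  let c : S4 := Equiv.swap 1 2 * Equiv.swap 2 3
  let t : S4 := Equiv.swap 1 2
  have hg : ∀ g : S4, ∃ i j : Fin 2, ∃ k : Fin 3, ∃ l : Fin 2,
      g = a ^ (i : ℕ) * b ^ (j : ℕ) * (c ^ (k : ℕ) * t ^ (l : ℕ)) := by decide +kernel
  -- Degree at least 10 = 2 · 4 + 2 puts f in the fifth power of the Klein invariants, exactly the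
  -- power needed for the quotient.
  have hm := klein_mem_fixedPart_pow h2 (a := polyAct ρ a) (b := polyAct ρ b)
    (polyAct_polyAct_of_mul_eq_one ρ (by decide)) (polyAct_polyAct_of_mul_eq_one ρ (by decide))
    (fun x => by rw [← polyAct_mul, ← polyAct_mul, show a * b = b * a by decide])
    (P := augmentation F n) (fun x hx y _ => augmentation_mul hx)
    (fun x hx => polyAct_mem_augmentation ρ a hx) (fun x hx => polyAct_mem_augmentation ρ b hx) 4
    (isHomogeneous_mem_augmentation_pow hfd (by omega) (by omega)) (hf a) (hf b)
  -- Conjugation by c and t permutes a, b and ab, so c and t preserve the Klein invariants.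
  have conj : ∀ (s u v : S4) (x : MvPolynomial (Fin n) F), s * u = u * v → polyAct ρ v x = x →
      polyAct ρ s (polyAct ρ u x) = polyAct ρ u x := by
    intro s u v x hs hv
    rw [← polyAct_mul, hs, polyAct_mul, hv]
  have hS : S3Action (polyAct ρ c) (polyAct ρ t)
      (fixedPart (polyAct ρ a) (polyAct ρ b) (augmentation F n)) :=
    { ccc := fun x => by
        rw [← polyAct_mul, ← polyAct_mul, show c * c * c = 1 by decide, polyAct_one]
      tt := polyAct_polyAct_of_mul_eq_one ρ (by decide)
      tc := fun x => by
        rw [← polyAct_mul, ← polyAct_mul, ← polyAct_mul, show t * c = c * c * t by decide]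
      mul := fun x hx y hy => ⟨augmentation_mul hx.1, by rw [map_mul, hx.2.1, hy.2.1],
        by rw [map_mul, hx.2.2, hy.2.2]⟩
      c_mem := fun x hx => ⟨polyAct_mem_augmentation ρ c hx.1,
        conj a c (a * b) x (by decide) (polyAct_fixed_mul hx.2.1 hx.2.2),
        conj b c a x (by decide) hx.2.1⟩
      t_mem := fun x hx => ⟨polyAct_mem_augmentation ρ t hx.1,
        conj a t b x (by decide) hx.2.2, conj b t a x (by decide) hx.2.1⟩ }
  have hm' := hS.mem_fixedPart_sq h2 h3 hm (hf c) (hf t)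
  refine mem_pow_of_forall_mem hm' fun x hx => ?_
  obtain ⟨⟨hx0, ha, hb⟩, hc, ht⟩ := hx
  refine mem_posInvariants.2 ⟨fun g => ?_, hx0⟩
  obtain ⟨i, j, k, l, rfl⟩ := hg g
  exact polyAct_fixed_mul (polyAct_fixed_mul (polyAct_fixed_pow ha _) (polyAct_fixed_pow hb _))
    (polyAct_fixed_mul (polyAct_fixed_pow hc _) (polyAct_fixed_pow ht _))

end UpperBounds

/-! ### The normal Klein four-group and its quotient -/

section NormalKlein

/-- The action of the symmetric group of degree four on the three partitions of the set of
letters into two pairs, as a homomorphism onto the dihedral group of order six. -/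
def toDihedral : S4 →* DihedralGroup 3 where
  toFun g :=
    -- Letters are vectors over the field with two elements, added by `^^^`. The difference 1, 2 or
    -- 3 of two letters names a partition into pairs, relabelled 0, 1, 2; the entry at index 0 plays
    -- no role. Since p 1 and p 2 are the images of the labels 0 and 1, g acts on labels by x ↦ p 1
    -- + x or x ↦ p 1 - x.
    let p : Fin 4 → ZMod 3 := fun i => ![2, 0, 1, 2] (g 0 ^^^ g i)
    if p 2 = p 1 + 1 then .r (p 1) else .sr (-p 1)
  map_one' := by decide
  map_mul' := by decide +kernel

theorem toDihedral_surjective : Function.Surjective toDihedral := by decide +kernel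

/-- The embedding of the Klein four-group as a normal subgroup of the symmetric group. -/
def kleinHom : KleinFour →* S4 where
  toFun x := (if x.1 = 1 then 1 else Equiv.swap 0 1 * Equiv.swap 2 3) *
    (if x.2 = 1 then 1 else Equiv.swap 0 2 * Equiv.swap 1 3)
  map_one' := by decide
  map_mul' := by decide +kernel

theorem kleinHom_injective : Function.Injective kleinHom := by decide +kernel

theorem range_kleinHom : kleinHom.range = toDihedral.ker := by
  have h : ∀ g : S4, (∃ x, kleinHom x = g) ↔ toDihedral g = 1 := by decide +kernel
  ext g
  rw [MonoidHom.mem_range, MonoidHom.mem_ker, h]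

theorem exists_normal_klein : ∃ (N : Subgroup S4) (_ : N.Normal),
    Nonempty (N ≃* KleinFour) ∧ Nonempty (S4 ⧸ N ≃* DihedralGroup 3) := by
  refine ⟨toDihedral.ker, inferInstance, ⟨?_⟩,
    ⟨QuotientGroup.quotientKerEquivOfSurjective toDihedral toDihedral_surjective⟩⟩
  exact (MulEquiv.subgroupCongr range_kleinHom.symm).trans
    (MonoidHom.ofInjective kleinHom_injective).symm

end NormalKlein

/-! ### Lower bound for the Klein four-group -/

section KleinLowerBound

variable {F : Type*} [Field F] {G : Type*} [Group G] {n : ℕ}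

theorem homogeneousComponent_mul {σ : Type*} (i : ℕ) (f g : MvPolynomial σ F) :
    homogeneousComponent i (f * g) = ∑ x ∈ Finset.HasAntidiagonal.antidiagonal i,
      homogeneousComponent x.1 f * homogeneousComponent x.2 g := by
  classical
  ext d
  simp only [coeff_homogeneousComponent, coeff_sum, coeff_mul]
  rw [Finset.sum_comm]
  have key : ∀ x ∈ Finset.HasAntidiagonal.antidiagonal d, ∑ y ∈ Finset.HasAntidiagonal.antidiagonal i,
      (if x.1.degree = y.1 then coeff x.1 f else 0) * (if x.2.degree = y.2 then coeff x.2 g else 0) =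
      if d.degree = i then coeff x.1 f * coeff x.2 g else 0 := by
    intro x hx
    have hd : x.1.degree + x.2.degree = d.degree := by
      rw [← map_add, Finset.HasAntidiagonal.mem_antidiagonal.1 hx]
    split_ifs with h
    · rw [Finset.sum_eq_single (x.1.degree, x.2.degree)]
      · simp
      · intro y _ hne
        by_cases h1 : x.1.degree = y.1
        · have h2 : x.2.degree ≠ y.2 := fun h2 => hne (Prod.ext h1.symm h2.symm)
          rw [if_neg h2, mul_zero]
        · rw [if_neg h1, zero_mul]
      · intro hn
        exact absurd (Finset.HasAntidiagonal.mem_antidiagonal.2 (hd.trans h)) hn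
    · refine Finset.sum_eq_zero fun y hy => ?_
      have hy := Finset.HasAntidiagonal.mem_antidiagonal.1 hy
      by_cases h1 : x.1.degree = y.1
      · rw [if_neg (show x.2.degree ≠ y.2 by omega), mul_zero]
      · rw [if_neg h1, zero_mul]
  rw [Finset.sum_congr rfl key]
  split_ifs <;> simp

theorem homogeneousComponent_mul_of_isHomogeneous {σ : Type*} {e : ℕ} {f : MvPolynomial σ F}
    (hf : f.IsHomogeneous e) (i : ℕ) (g : MvPolynomial σ F) :
    homogeneousComponent (e + i) (f * g) = f * homogeneousComponent i g := by
  rw [homogeneousComponent_mul, Finset.sum_eq_single (e, i)]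
  · rw [homogeneousComponent_eq_self hf]
  · intro y hy hne
    rw [homogeneousComponent_of_mem hf, if_neg, zero_mul]
    intro h
    have := Finset.HasAntidiagonal.mem_antidiagonal.1 hy
    exact hne (Prod.ext_iff.2 ⟨h, by simp only; omega⟩)
  · intro h
    exact absurd (Finset.HasAntidiagonal.mem_antidiagonal.2 (show e + i = e + i from rfl)) h

theorem homogeneousComponent_pow_eq_zero {P : Submodule F (MvPolynomial (Fin n) F)} {e : ℕ}
    (hP : ∀ f ∈ P, ∀ i < e, homogeneousComponent i f = 0) (m : ℕ) {f : MvPolynomial (Fin n) F}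
    (hf : f ∈ P ^ m) {i : ℕ} (hi : i < e * m) : homogeneousComponent i f = 0 := by
  induction m generalizing f i with
  | zero => simp at hi
  | succ m ih =>
    rw [pow_succ] at hf
    refine Submodule.mul_induction_on hf (fun a ha b hb => ?_) fun a b ha hb => ?_
    · rw [homogeneousComponent_mul]
      refine Finset.sum_eq_zero fun x hx => ?_
      have hx := Finset.HasAntidiagonal.mem_antidiagonal.1 hx
      rw [mul_add] at hi
      by_cases h : x.1 < e * m
      · rw [ih ha h, zero_mul]
      · rw [hP b hb x.2 (by omega), mul_zero]
    · rw [map_add, ha, hb, add_zero]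

/-- The representation of the Klein four-group that is the sum of its nontrivial characters. -/
def kleinRep (F : Type*) [Field F] : Representation F KleinFour (Fin 3 → F) where
  toFun g := LinearMap.pi fun i =>
    (![signChar F g.1, signChar F g.2, signChar F (g.1 * g.2)] i) • LinearMap.proj i
  map_one' := by
    ext i j
    fin_cases j <;> simp
  map_mul' g h := by
    ext i j
    fin_cases j <;> simp [mul_assoc, mul_left_comm]

theorem polyAct_kleinRep (g : KleinFour) (i : Fin 3) : polyAct (kleinRep F) g (X i) =
    C (![signChar F g.1, signChar F g.2, signChar F (g.1 * g.2)] i) * X i := by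
  have hinv : g⁻¹ = g := by revert g; decide
  have hM : ∀ j k, LinearMap.toMatrix' (kleinRep F g) j k =
      if j = k then ![signChar F g.1, signChar F g.2, signChar F (g.1 * g.2)] j else 0 := by
    intro j k
    rw [LinearMap.toMatrix'_apply]
    simp [kleinRep, Pi.single_apply]
  rw [polyAct_X, hinv]
  simp only [hM]
  rw [Finset.sum_eq_single i]
  · simp
  · intro j _ hj
    rw [if_neg hj.symm, C_0, zero_mul]
  · simp

theorem homogeneousComponent_one_eq_zero_of_kleinRep (h2 : (2 : F) ≠ 0)
    {f : MvPolynomial (Fin 3) F} (hf : f ∈ invariants (kleinRep F)) :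
    homogeneousComponent 1 f = 0 := by
  have hinv := homogeneousComponent_mem_invariants hf 1
  have hmem : homogeneousComponent 1 f ∈ Submodule.span F (Set.range (X : Fin 3 → MvPolynomial (Fin 3) F)) := by
    rw [← homogeneousSubmodule_one_eq_span_X]
    exact homogeneousComponent_mem 1 f
  obtain ⟨u, hu⟩ := (Submodule.mem_span_range_iff_exists_fun F).1 hmem
  rw [← hu] at hinv ⊢
  have hX : ∀ g : KleinFour, ∑ i, (u i * (![signChar F g.1, signChar F g.2,
      signChar F (g.1 * g.2)] i) - u i) • (X i : MvPolynomial (Fin 3) F) = 0 := by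
    intro g
    have := hinv g
    simp only [map_sum, map_smul, polyAct_kleinRep] at this
    simp only [sub_smul, Finset.sum_sub_distrib, sub_eq_zero]
    rw [← this]
    refine Finset.sum_congr rfl fun i _ => ?_
    rw [← smul_eq_C_mul, smul_smul]
  have hli : LinearIndependent F (X : Fin 3 → MvPolynomial (Fin 3) F) := linearIndependent_X _ _
  have hu' : ∀ (g : KleinFour) i, u i * (![signChar F g.1, signChar F g.2, signChar F (g.1 * g.2)] i) - u i = 0 :=
    fun g i => Fintype.linearIndependent_iff.1 hli _ (hX g) i
  have h1 : (Multiplicative.ofAdd 1 : Multiplicative (ZMod 2)) ≠ 1 := by decide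
  have hz : ∀ x : F, x * -1 - x = 0 → x = 0 := by
    intro x hx
    have : 2 * x = 0 := by linear_combination -hx
    exact (mul_eq_zero.1 this).resolve_left h2
  have u0 : u 0 = 0 := hz _ (by
    simpa [signChar_of_ne_one F h1] using hu' (Multiplicative.ofAdd 1, 1) 0)
  have u1 : u 1 = 0 := hz _ (by
    simpa [signChar_of_ne_one F h1] using hu' (1, Multiplicative.ofAdd 1) 1)
  have u2 : u 2 = 0 := hz _ (by
    simpa [signChar_of_ne_one F h1] using hu' (1, Multiplicative.ofAdd 1) 2)
  simp [Fin.sum_univ_three, u0, u1, u2]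

/-- The invariant (x₀x₁x₂)³ has degree 9. A sum of nontrivial characters has no linear invariants,
so products of five positive-degree invariants start in degree 10. -/
theorem le_beta_kleinFour (h2 : (2 : F) ≠ 0) : 9 ≤ beta F KleinFour 4 := by
  refine le_trans ?_ (betaModule_le_beta (kleinRep F) 4)
  have hm : ((X 0 * X 1 * X 2) ^ 3 : MvPolynomial (Fin 3) F).IsHomogeneous 9 :=
    (((isHomogeneous_X F 0).mul (isHomogeneous_X F 1)).mul (isHomogeneous_X F 2)).pow 3
  refine le_betaModule (d := 9) (f := (X 0 * X 1 * X 2) ^ 3) (fun g => ?_) hm (by norm_num) ?_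
  · have hs : ∀ x : Multiplicative (ZMod 2), signChar F x * signChar F x = 1 := by
      intro x
      rw [← map_mul, show x * x = 1 by revert x; decide, map_one]
    have h1 : polyAct (kleinRep F) g (X 0 * X 1 * X 2) = X 0 * X 1 * X 2 := by
      rw [map_mul, map_mul, polyAct_kleinRep, polyAct_kleinRep, polyAct_kleinRep]
      simp only [Matrix.cons_val, map_mul]
      have e1 : (C (signChar F g.1) * C (signChar F g.1) : MvPolynomial (Fin 3) F) = 1 := by
        rw [← C_mul, hs, C_1]
      have e2 : (C (signChar F g.2) * C (signChar F g.2) : MvPolynomial (Fin 3) F) = 1 := by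
        rw [← C_mul, hs, C_1]
      linear_combination (X 0 * X 1 * X 2) * (C (signChar F g.2) * C (signChar F g.2)) * e1 +
        (X 0 * X 1 * X 2) * e2
    rw [map_pow, h1]
  · intro hcon
    have h0 := homogeneousComponent_pow_eq_zero (e := 2) (i := 9) (fun f hf i hi => ?_) 5 hcon
      (by norm_num)
    · rw [homogeneousComponent_eq_self hm] at h0
      exact absurd h0 (pow_ne_zero _ (mul_ne_zero (mul_ne_zero (X_ne_zero 0) (X_ne_zero 1))
        (X_ne_zero 2)))
    · obtain ⟨hi1, hi2⟩ := mem_posInvariants.1 hf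
      interval_cases i
      · exact homogeneousComponent_zero_of_mem_augmentation hi2
      · exact homogeneousComponent_one_eq_zero_of_kleinRep h2 hi1

theorem beta_kleinFour (h2 : (2 : F) ≠ 0) : beta F KleinFour 4 = 9 :=
  le_antisymm (iSup₂_le fun _ ρ => betaModule_kleinFour_le h2 ρ) (le_beta_kleinFour h2)

end KleinLowerBound

/-! ### Symmetric and antisymmetric polynomials -/

section Antisymmetric

variable {F : Type*} [Field F] {n : ℕ}

theorem permRep_inv_apply (g : Equiv.Perm (Fin n)) (v : Fin n → F) (j : Fin n) :
    permRep F n g⁻¹ v j = v (g j) := rfl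

theorem permSignRep_inv_apply (g : Equiv.Perm (Fin n)) (v : Fin n → F) (j : Fin n) :
    permSignRep F n g⁻¹ v j = ((Equiv.Perm.sign g⁻¹ : ℤ) : F) * v (g j) := rfl

theorem polyAct_permRep (g : Equiv.Perm (Fin n)) (f : MvPolynomial (Fin n) F) :
    polyAct (permRep F n) g f = rename g f := by
  have h : polyAct (permRep F n) g = rename g := by
    refine MvPolynomial.algHom_ext fun j => ?_
    rw [polyAct_X, rename_X, Finset.sum_eq_single (g j)]
    · rw [LinearMap.toMatrix'_apply, permRep_inv_apply]
      simp
    · intro i _ hi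
      rw [LinearMap.toMatrix'_apply, permRep_inv_apply]
      simp [hi.symm]
    · simp
  rw [h]

theorem mem_invariants_permRep {f : MvPolynomial (Fin n) F} :
    f ∈ invariants (permRep F n) ↔ f.IsSymmetric :=
  forall_congr' fun g => by rw [polyAct_permRep]

/-- The sign of a permutation as a scalar. -/
def signF (F : Type*) [Field F] (g : Equiv.Perm (Fin n)) : F := ((Equiv.Perm.sign g : ℤ) : F)

theorem signF_mul_self (g : Equiv.Perm (Fin n)) : signF F g * signF F g = 1 := by
  rw [signF]
  rcases Int.units_eq_one_or (Equiv.Perm.sign g) with h | h <;> simp [h]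

theorem polyAct_permSignRep_X (g : Equiv.Perm (Fin n)) (j : Fin n) :
    polyAct (permSignRep F n) g (X j) = C (signF F g) * X (g j) := by
  rw [polyAct_X, Finset.sum_eq_single (g j)]
  · rw [LinearMap.toMatrix'_apply, permSignRep_inv_apply]
    simp [signF]
  · intro i _ hi
    rw [LinearMap.toMatrix'_apply, permSignRep_inv_apply]
    simp [hi.symm]
  · simp

/-- Each variable contributes one factor sign g; hence only the parity of the degree matters for
invariance. -/
theorem polyAct_permSignRep {d : ℕ} {f : MvPolynomial (Fin n) F} (hf : f.IsHomogeneous d)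
    (g : Equiv.Perm (Fin n)) :
    polyAct (permSignRep F n) g f = C (signF F g) ^ d * rename g f := by
  have h1 : polyAct (permSignRep F n) g = aeval fun j => C (signF F g) * X (g j) :=
    MvPolynomial.algHom_ext fun j => by rw [polyAct_permSignRep_X, aeval_X]
  have h2 : (rename g : MvPolynomial (Fin n) F →ₐ[F] _) = aeval fun j => X (g j) :=
    MvPolynomial.algHom_ext fun j => by rw [rename_X, aeval_X]
  rw [h1, h2, aeval_def, aeval_def, eval₂_eq', eval₂_eq', Finset.mul_sum]
  refine Finset.sum_congr rfl fun m hm => ?_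
  have hdeg : ∑ i, m i = d := by
    rw [← Finsupp.degree_eq_sum]
    exact not_ne_iff.1 (mt hf.coeff_eq_zero (mem_support_iff.1 hm))
  simp only [mul_pow]
  rw [Finset.prod_mul_distrib, Finset.prod_pow_eq_pow_sum, hdeg]
  ring

/-- Antisymmetric polynomials. -/
def IsAntisymmetric (f : MvPolynomial (Fin n) F) : Prop :=
  ∀ g : Equiv.Perm (Fin n), rename g f = C (signF F g) * f

theorem mem_invariants_permSignRep_even {d : ℕ} (hd : Even d) {f : MvPolynomial (Fin n) F}
    (hf : f.IsHomogeneous d) : f ∈ invariants (permSignRep F n) ↔ f.IsSymmetric := by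
  refine forall_congr' fun g => ?_
  obtain ⟨k, rfl⟩ := hd
  rw [polyAct_permSignRep hf, pow_add, ← mul_pow, ← C_mul, signF_mul_self, C_1, one_pow, one_mul]

theorem mem_invariants_permSignRep_odd {d : ℕ} (hd : Odd d) {f : MvPolynomial (Fin n) F}
    (hf : f.IsHomogeneous d) : f ∈ invariants (permSignRep F n) ↔ IsAntisymmetric f := by
  refine forall_congr' fun g => ?_
  obtain ⟨k, rfl⟩ := hd
  have hs : (C (signF F g) : MvPolynomial (Fin n) F) * C (signF F g) = 1 := by
    rw [← C_mul, signF_mul_self, C_1]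
  rw [polyAct_permSignRep hf, pow_succ, two_mul, pow_add, ← mul_pow, hs, one_pow, one_mul]
  constructor <;> intro h
  · linear_combination C (signF F g) * h - rename g f * hs
  · linear_combination C (signF F g) * h + f * hs

theorem vdm_eq_prod : vdm F n = ∏ p ∈ (Finset.univ : Finset (Fin n)).sigma fun i => Finset.Ioi i,
    (X p.2 - X p.1) := by
  rw [vdm, Matrix.det_vandermonde, Finset.prod_sigma]

theorem vdm_ne_zero : vdm F n ≠ 0 :=
  Matrix.det_vandermonde_ne_zero_iff.2 X_injective

theorem vdm_isAntisymmetric : IsAntisymmetric (vdm F n) := by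
  intro g
  have h : (rename g : MvPolynomial (Fin n) F →ₐ[F] _).mapMatrix
      (Matrix.vandermonde fun i : Fin n => (X i : MvPolynomial (Fin n) F)) =
      (Matrix.vandermonde fun i : Fin n => (X i : MvPolynomial (Fin n) F)).submatrix g id := by
    ext1 i j
    simp [Matrix.vandermonde_apply]
  rw [vdm, AlgHom.map_det, h, Matrix.det_permute, signF]
  simp

theorem vdm_isHomogeneous :
    (vdm F n).IsHomogeneous (∑ i : Fin n, (Finset.Ioi i).card) := by
  rw [vdm, Matrix.det_vandermonde]
  refine IsHomogeneous.prod _ _ _ fun i _ => ?_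
  rw [Finset.card_eq_sum_ones]
  exact IsHomogeneous.prod _ _ _ fun j _ => (isHomogeneous_X F j).sub (isHomogeneous_X F i)

/-- The substitution that identifies the variable `X j` with `X i`. -/
noncomputable def identify (F : Type*) [Field F] (i j : Fin n) :
    MvPolynomial (Fin n) F →ₐ[F] MvPolynomial (Fin n) F :=
  aeval fun k => X (if k = j then i else k)

theorem identify_X (i j k : Fin n) :
    identify F i j (X k) = X (if k = j then i else k) := by
  rw [identify, aeval_X]

theorem dvd_sub_identify (i j : Fin n) (f : MvPolynomial (Fin n) F) :
    X j - X i ∣ f - identify F i j f := by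
  induction f using MvPolynomial.induction_on with
  | C a => simp [identify]
  | add p q hp hq =>
    rw [map_add, add_sub_add_comm]
    exact dvd_add hp hq
  | mul_X p k hp =>
    have hX : (X j - X i : MvPolynomial (Fin n) F) ∣ X k - identify F i j (X k) := by
      rw [identify_X]
      split_ifs with h
      · rw [h]
      · rw [sub_self]; exact dvd_zero _
    rw [map_mul, show p * X k - identify F i j p * identify F i j (X k) =
      (p - identify F i j p) * X k + identify F i j p * (X k - identify F i j (X k)) by ring]
    exact dvd_add (hp.mul_right _) (hX.mul_left _)

/-- The transposition of i and j negates f but is invisible after the two variables are identified,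
so the result equals its own negative. -/
theorem IsAntisymmetric.identify_eq_zero (h2 : (2 : F) ≠ 0) {f : MvPolynomial (Fin n) F}
    (hf : IsAntisymmetric f) {i j : Fin n} (hij : i ≠ j) : identify F i j f = 0 := by
  have h : (identify F i j).comp (rename (Equiv.swap i j)) = identify F i j := by
    refine MvPolynomial.algHom_ext fun k => ?_
    rw [AlgHom.comp_apply, rename_X, identify_X, identify_X]
    congr 1
    by_cases hk : k = j
    · simp [hk, hij]
    · by_cases hk' : k = i
      · simp [hk', hij]
      · rw [Equiv.swap_apply_of_ne_of_ne hk' hk]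
  have h1 := DFunLike.congr_fun h f
  rw [AlgHom.comp_apply, hf, signF, Equiv.Perm.sign_swap hij, map_mul] at h1
  have h3 : (2 : MvPolynomial (Fin n) F) * identify F i j f = 0 := by
    have : identify F i j (C (((-1 : ℤˣ) : ℤ) : F)) = -1 := by simp
    rw [this] at h1
    linear_combination -h1
  refine (mul_eq_zero.1 h3).resolve_left ?_
  rw [← map_ofNat C 2]
  exact C_ne_zero.2 h2

/-- The linear factors are split off one at a time. Identifying X_j with X_i kills f but none of the
factors already split off, so it kills the cofactor, which is then divisible by X_j - X_i. Only the
absence of zero divisors is used, not unique factorization. -/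
theorem IsAntisymmetric.vdm_dvd (h2 : (2 : F) ≠ 0) {f : MvPolynomial (Fin n) F}
    (hf : IsAntisymmetric f) : vdm F n ∣ f := by
  classical
  rw [vdm_eq_prod]
  have key : ∀ T : Finset (Σ _ : Fin n, Fin n), (∀ p ∈ T, p.1 < p.2) →
      ∏ p ∈ T, (X p.2 - X p.1) ∣ f := by
    intro T
    induction T using Finset.induction_on with
    | empty => simp
    | insert p T hp ih =>
      intro hT
      obtain ⟨h, hh⟩ := ih fun q hq => hT q (Finset.mem_insert_of_mem hq)
      obtain ⟨i, j⟩ := p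
      have hij : i < j := hT ⟨i, j⟩ (Finset.mem_insert_self _ _)
      have hz := hf.identify_eq_zero h2 hij.ne
      rw [hh, map_mul, map_prod, mul_eq_zero, Finset.prod_eq_zero_iff] at hz
      have hEh : identify F i j h = 0 := by
        refine hz.resolve_left ?_
        rintro ⟨⟨k, l⟩, hq, h0⟩
        have hkl : k < l := hT ⟨k, l⟩ (Finset.mem_insert_of_mem hq)
        rw [map_sub, identify_X, identify_X, sub_eq_zero] at h0
        replace h0 := X_injective h0
        simp only at h0
        split_ifs at h0 with e1 e2 e2
        · exact hkl.ne (e2.trans e1.symm)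
        · subst e1 h0
          exact hp hq
        · subst e2 h0
          exact absurd (hij.trans hkl) (lt_irrefl _)
        · exact hkl.ne h0.symm
      have hd := dvd_sub_identify i j h
      rw [hEh, sub_zero] at hd
      rw [Finset.prod_insert hp, mul_comm, hh]
      exact mul_dvd_mul_left _ hd
  exact key _ fun p hp => by simpa using hp

theorem IsAntisymmetric.exists_eq_vdm_mul (h2 : (2 : F) ≠ 0) {f : MvPolynomial (Fin n) F}
    (hf : IsAntisymmetric f) : ∃ q : MvPolynomial (Fin n) F, q.IsSymmetric ∧ f = vdm F n * q := by
  obtain ⟨q, rfl⟩ := hf.vdm_dvd h2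
  refine ⟨q, fun g => ?_, rfl⟩
  have h := hf g
  rw [map_mul, vdm_isAntisymmetric g, ← mul_assoc] at h
  refine mul_left_cancel₀ (mul_ne_zero (C_ne_zero.2 fun h0 => ?_) vdm_ne_zero) h
  have := signF_mul_self (F := F) g
  rw [h0, zero_mul] at this
  exact zero_ne_one this

theorem esymm_isHomogeneous (k : ℕ) : (esymm (Fin n) F k).IsHomogeneous k := by
  rw [esymm]
  refine IsHomogeneous.sum _ _ _ fun s hs => ?_
  rw [← (Finset.mem_powersetCard.1 hs).2, Finset.card_eq_sum_ones]
  exact IsHomogeneous.prod _ _ _ fun i _ => isHomogeneous_X F i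

/-- A graded form of the fundamental theorem: taking the degree-d component of a polynomial
expression for f discards the monomials of the wrong weight. -/
theorem mem_span_esymm {d : ℕ} {f : MvPolynomial (Fin n) F} (hf : f.IsHomogeneous d)
    (hs : f.IsSymmetric) : f ∈ Submodule.span F
      {p | ∃ m : Fin n → ℕ, ∑ i : Fin n, ((i : ℕ) + 1) * m i = d ∧
        p = ∏ i : Fin n, esymm (Fin n) F (i + 1) ^ m i} := by
  obtain ⟨p, hp⟩ := esymmAlgHom_surjective (σ := Fin n) (R := F) (n := n) (by simp)
    ⟨f, hs⟩
  have hp' : aeval (fun i : Fin n => esymm (Fin n) F (i + 1)) p = f := by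
    rw [← esymmAlgHom_apply, hp]
  rw [← homogeneousComponent_eq_self hf, ← hp', aeval_def, eval₂_eq', map_sum]
  refine Submodule.sum_mem _ fun m _ => ?_
  rw [algebraMap_eq, homogeneousComponent_C_mul, ← smul_eq_C_mul]
  refine Submodule.smul_mem _ _ ?_
  have hm : (∏ i : Fin n, esymm (Fin n) F (i + 1) ^ m i).IsHomogeneous
      (∑ i : Fin n, ((i : ℕ) + 1) * m i) :=
    IsHomogeneous.prod _ _ _ fun i _ => (esymm_isHomogeneous _).pow _
  rw [homogeneousComponent_of_mem hm]
  split_ifs with h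
  · exact Submodule.subset_span ⟨m, h.symm, rfl⟩
  · exact Submodule.zero_mem _

end Antisymmetric

/-! ### Invariants of V ⊗ sign by parity of the degree -/

section SignInvariants

variable {F : Type*} [Field F] {n : ℕ}

theorem isSymmetric_homogeneousComponent {f : MvPolynomial (Fin n) F} (hf : f.IsSymmetric)
    (d : ℕ) : (homogeneousComponent d f).IsSymmetric :=
  mem_invariants_permRep.1 (homogeneousComponent_mem_invariants (mem_invariants_permRep.2 hf) d)

theorem isAntisymmetric_vdm_mul {q : MvPolynomial (Fin n) F} (hq : q.IsSymmetric) :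
    IsAntisymmetric (vdm F n * q) := fun g => by
  rw [map_mul, vdm_isAntisymmetric g, hq g, mul_assoc]

/-- The degree of the Vandermonde determinant. -/
abbrev vdmDegree (n : ℕ) : ℕ := ∑ i : Fin n, (Finset.Ioi i).card

/-- As f and Δ are both homogeneous, the symmetric cofactor can be replaced by a single homogeneous
component. The degree equation also shows that there are no nonzero odd invariants below the degree
of Δ. -/
theorem exists_eq_vdm_mul_of_odd (h2 : (2 : F) ≠ 0) {d : ℕ} (hd : Odd d)
    {f : MvPolynomial (Fin n) F} (hf : f ∈ invariants (permSignRep F n)) (hfd : f.IsHomogeneous d)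
    (h0 : f ≠ 0) : ∃ (e : ℕ) (q : MvPolynomial (Fin n) F), d = vdmDegree n + e ∧ q.IsSymmetric ∧
      q.IsHomogeneous e ∧ f = vdm F n * q := by
  obtain ⟨q, hq, rfl⟩ :=
    ((mem_invariants_permSignRep_odd hd hfd).1 hf).exists_eq_vdm_mul h2
  have hq0 : q ≠ 0 := right_ne_zero_of_mul h0
  have htd := totalDegree_mul_of_isDomain (vdm_ne_zero (F := F) (n := n)) hq0
  rw [hfd.totalDegree h0, vdm_isHomogeneous.totalDegree vdm_ne_zero] at htd
  refine ⟨q.totalDegree, homogeneousComponent q.totalDegree q, htd,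
    isSymmetric_homogeneousComponent hq _, homogeneousComponent_isHomogeneous _ _, ?_⟩
  rw [← homogeneousComponent_mul_of_isHomogeneous vdm_isHomogeneous, ← htd,
    homogeneousComponent_eq_self hfd]

theorem vdmDegree_four : vdmDegree 4 = 6 := by decide

theorem vdmDegree_three : vdmDegree 3 = 3 := by decide

theorem vdm_four_isHomogeneous : (vdm F 4).IsHomogeneous 6 := vdm_isHomogeneous

theorem vdm_mul_mem_invariants {d : ℕ} (hd : Odd d) {q : MvPolynomial (Fin 4) F}
    (hq : q.IsSymmetric) (hqd : q.IsHomogeneous d) :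
    vdm F 4 * q ∈ invariants (permSignRep F 4) :=
  (mem_invariants_permSignRep_odd (Even.add_odd (by decide : Even 6) hd)
    (vdm_four_isHomogeneous.mul hqd)).2 (isAntisymmetric_vdm_mul hq)

theorem toSubmodule_invariants_permSignRep (h2 : (2 : F) ≠ 0) :
    Subalgebra.toSubmodule (invariants (permSignRep F 4)) =
      evenPart (invariants (permRep F 4)) ⊔
        (oddPart (invariants (permRep F 4))).map (LinearMap.mulLeft F (vdm F 4)) := by
  apply le_antisymm
  · intro f hf
    rw [← sum_homogeneousComponent f]
    refine Submodule.sum_mem _ fun d _ => ?_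
    have hd := homogeneousComponent_mem_invariants ((Subalgebra.mem_toSubmodule _).1 hf) d
    have hh := homogeneousComponent_isHomogeneous d f
    rcases Nat.even_or_odd d with he | ho
    · exact Submodule.mem_sup_left (Submodule.subset_span ⟨mem_invariants_permRep.2
        ((mem_invariants_permSignRep_even he hh).1 hd), d, he, hh⟩)
    · by_cases h0 : homogeneousComponent d f = 0
      · rw [h0]; exact Submodule.zero_mem _
      · obtain ⟨e, q, hde, hq, hqe, heq⟩ := exists_eq_vdm_mul_of_odd h2 ho hd hh h0
        rw [heq]
        refine Submodule.mem_sup_right (Submodule.mem_map_of_mem (f := LinearMap.mulLeft F (vdm F 4))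
          (Submodule.subset_span ⟨mem_invariants_permRep.2 hq, e, ?_, hqe⟩))
        rw [vdmDegree_four] at hde
        rw [Nat.odd_iff] at ho ⊢
        omega
  · refine sup_le (Submodule.span_le.2 ?_) (Submodule.map_le_iff_le_comap.2 (Submodule.span_le.2 ?_))
    · rintro f ⟨hf, d, hd, hfd⟩
      exact (mem_invariants_permSignRep_even hd hfd).2 (mem_invariants_permRep.1 hf)
    · rintro f ⟨hf, d, hd, hfd⟩
      exact vdm_mul_mem_invariants hd (mem_invariants_permRep.1 hf) hfd

theorem disjoint_even_vdm_mul_odd (h2 : (2 : F) ≠ 0) :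
    Disjoint (evenPart (invariants (permRep F 4)))
      ((oddPart (invariants (permRep F 4))).map (LinearMap.mulLeft F (vdm F 4))) := by
  rw [Submodule.disjoint_def]
  intro f hf hf'
  have he : evenPart (invariants (permRep F 4)) ≤ Subalgebra.toSubmodule (invariants (permRep F 4)) :=
    Submodule.span_le.2 fun f hf => hf.1
  have ho : oddPart (invariants (permRep F 4)) ≤ Subalgebra.toSubmodule (invariants (permRep F 4)) :=
    Submodule.span_le.2 fun f hf => hf.1
  have h1 := mem_invariants_permRep.1 (he hf) (Equiv.swap 0 1)
  obtain ⟨q, hq, rfl⟩ := hf'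
  have h3 := isAntisymmetric_vdm_mul (mem_invariants_permRep.1 (ho hq)) (Equiv.swap 0 1)
  rw [LinearMap.mulLeft_apply] at h1 ⊢
  rw [h1, signF, Equiv.Perm.sign_swap (by decide)] at h3
  have h4 : (2 : MvPolynomial (Fin 4) F) * (vdm F 4 * q) = 0 := by
    have : (C (((-1 : ℤˣ) : ℤ) : F) : MvPolynomial (Fin 4) F) = -1 := by simp
    rw [this] at h3
    linear_combination h3
  refine (mul_eq_zero.1 h4).resolve_left ?_
  rw [← map_ofNat C 2]
  exact C_ne_zero.2 h2

end SignInvariants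

/-! ### Generators of the invariants of V ⊗ sign -/

section Generators

variable {F : Type*} [Field F]

/-- The generators of the invariants of the permutation representation tensored with the sign. -/
abbrev signGenerators (F : Type*) [Field F] : Set (MvPolynomial (Fin 4) F) :=
  {esymm (Fin 4) F 2, esymm (Fin 4) F 1 ^ 2, esymm (Fin 4) F 1 * esymm (Fin 4) F 3,
    esymm (Fin 4) F 4, esymm (Fin 4) F 3 ^ 2, esymm (Fin 4) F 1 * vdm F 4,
    esymm (Fin 4) F 3 * vdm F 4}

theorem signGenerators_subset :
    signGenerators F ⊆ invariants (permSignRep F 4) := by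
  have hs := fun k => esymm_isSymmetric (Fin 4) F k
  have hh := fun k => esymm_isHomogeneous (F := F) (n := 4) k
  rintro f (rfl | rfl | rfl | rfl | rfl | rfl | rfl)
  · exact (mem_invariants_permSignRep_even (by decide) (hh 2)).2 (hs 2)
  · exact (mem_invariants_permSignRep_even (by decide) ((hh 1).pow 2)).2
      (by rw [pow_two]; exact (hs 1).mul (hs 1))
  · exact (mem_invariants_permSignRep_even (by decide) ((hh 1).mul (hh 3))).2 ((hs 1).mul (hs 3))
  · exact (mem_invariants_permSignRep_even (by decide) (hh 4)).2 (hs 4)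
  · exact (mem_invariants_permSignRep_even (by decide) ((hh 3).pow 2)).2
      (by rw [pow_two]; exact (hs 3).mul (hs 3))
  · rw [mul_comm]; exact vdm_mul_mem_invariants (by decide) (hs 1) (hh 1)
  · rw [mul_comm]; exact vdm_mul_mem_invariants (by decide) (hs 3) (hh 3)

theorem pow_mul_pow_mem_of_even {A : Type*} [CommRing A] [Algebra F A] {B : Subalgebra F A}
    {x y : A} (hxx : x ^ 2 ∈ B) (hxy : x * y ∈ B) (hyy : y ^ 2 ∈ B) {a b : ℕ} (h : Even (a + b)) :
    x ^ a * y ^ b ∈ B := by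
  rcases Nat.even_or_odd' a with ⟨k, rfl | rfl⟩ <;> rcases Nat.even_or_odd' b with ⟨l, rfl | rfl⟩
  · rw [pow_mul, pow_mul]
    exact mul_mem (pow_mem hxx k) (pow_mem hyy l)
  · rw [Nat.even_iff] at h; omega
  · rw [Nat.even_iff] at h; omega
  · rw [show x ^ (2 * k + 1) * y ^ (2 * l + 1) = (x ^ 2) ^ k * (y ^ 2) ^ l * (x * y) by ring]
    exact mul_mem (mul_mem (pow_mem hxx k) (pow_mem hyy l)) hxy

theorem mul_pow_mul_pow_mem_of_odd {A : Type*} [CommRing A] [Algebra F A] {B : Subalgebra F A}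
    {x y z : A} (hxx : x ^ 2 ∈ B) (hxy : x * y ∈ B) (hyy : y ^ 2 ∈ B) (hxz : x * z ∈ B)
    (hyz : y * z ∈ B) {a b : ℕ} (h : Odd (a + b)) : z * (x ^ a * y ^ b) ∈ B := by
  rcases Nat.eq_zero_or_pos a with rfl | ha
  · obtain ⟨k, hk⟩ := h
    obtain rfl : b = 2 * k + 1 := by omega
    rw [show z * (x ^ 0 * y ^ (2 * k + 1)) = (y ^ 2) ^ k * (y * z) by ring]
    exact mul_mem (pow_mem hyy k) hyz
  · obtain ⟨c, rfl⟩ : ∃ c, a = c + 1 := ⟨a - 1, by omega⟩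
    rw [show z * (x ^ (c + 1) * y ^ b) = x ^ c * y ^ b * (x * z) by ring]
    refine mul_mem (pow_mul_pow_mem_of_even hxx hxy hyy ?_) hxz
    rw [Nat.odd_iff] at h
    rw [Nat.even_iff]
    omega

/-- The parity of the degree of a monomial in the σ_i is that of the joint exponent of σ₁ and σ₃. If
it is even these factors pair up; if it is odd one is left over and is absorbed by Δ. -/
theorem adjoin_signGenerators (h2 : (2 : F) ≠ 0) :
    Algebra.adjoin F (signGenerators F) = invariants (permSignRep F 4) := by
  refine le_antisymm (Algebra.adjoin_le signGenerators_subset) ?_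
  change Subalgebra.toSubmodule (invariants (permSignRep F 4)) ≤
    Subalgebra.toSubmodule (Algebra.adjoin F (signGenerators F))
  rw [toSubmodule_invariants_permSignRep h2]
  have hmem : ∀ f ∈ signGenerators F, f ∈ Algebra.adjoin F (signGenerators F) := fun f hf =>
    Algebra.subset_adjoin hf
  have g2 := hmem (esymm (Fin 4) F 2) (by simp)
  have g11 := hmem (esymm (Fin 4) F 1 ^ 2) (by simp)
  have g13 := hmem (esymm (Fin 4) F 1 * esymm (Fin 4) F 3) (by simp)
  have g4 := hmem (esymm (Fin 4) F 4) (by simp)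
  have g33 := hmem (esymm (Fin 4) F 3 ^ 2) (by simp)
  have g1d := hmem (esymm (Fin 4) F 1 * vdm F 4) (by simp)
  have g3d := hmem (esymm (Fin 4) F 3 * vdm F 4) (by simp)
  refine sup_le (Submodule.span_le.2 ?_) (Submodule.map_le_iff_le_comap.2 (Submodule.span_le.2 ?_))
  · rintro f ⟨hf, d, hd, hfd⟩
    refine (Submodule.span_le.2 ?_) (mem_span_esymm hfd (mem_invariants_permRep.1 hf))
    rintro _ ⟨m, hm, rfl⟩
    rw [Fin.prod_univ_four]
    rw [Fin.sum_univ_four] at hm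
    have h := mul_mem (mul_mem (pow_mul_pow_mem_of_even g11 g13 g33 (a := m 0) (b := m 2) (by
      simp at hm
      rw [Nat.even_iff] at hd ⊢
      omega)) (pow_mem g2 (m 1))) (pow_mem g4 (m 3))
    convert h using 1
    simp
    ring_nf
  · rintro f ⟨hf, d, hd, hfd⟩
    refine (Submodule.span_le (p := Submodule.comap (LinearMap.mulLeft F (vdm F 4)) _).2 ?_)
      (mem_span_esymm hfd (mem_invariants_permRep.1 hf))
    rintro _ ⟨m, hm, rfl⟩
    rw [Fin.prod_univ_four]
    rw [Fin.sum_univ_four] at hm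
    have h := mul_mem (mul_mem (mul_pow_mul_pow_mem_of_odd g11 g13 g33 g1d g3d (a := m 0) (b := m 2)
      (by
        simp at hm
        rw [Nat.odd_iff] at hd ⊢
        omega)) (pow_mem g2 (m 1))) (pow_mem g4 (m 3))
    change vdm F 4 * _ ∈ Algebra.adjoin F (signGenerators F)
    convert h using 1
    simp
    ring

end Generators

/-! ### Values of the elementary symmetric polynomials and of Δ -/

section Evaluation

variable {F : Type*} [Field F] {A : Type*} [CommRing A] [Algebra F A]

theorem aeval_esymm_four (v : Fin 4 → A) :
    aeval v (esymm (Fin 4) F 1) = v 0 + v 1 + v 2 + v 3 ∧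
    aeval v (esymm (Fin 4) F 2) =
      v 0 * v 1 + v 0 * v 2 + v 0 * v 3 + v 1 * v 2 + v 1 * v 3 + v 2 * v 3 ∧
    aeval v (esymm (Fin 4) F 3) =
      v 0 * v 1 * v 2 + v 0 * v 1 * v 3 + v 0 * v 2 * v 3 + v 1 * v 2 * v 3 ∧
    aeval v (esymm (Fin 4) F 4) = v 0 * v 1 * v 2 * v 3 := by
  have hu : (Finset.univ : Finset (Fin 4)).val.map v = {v 0, v 1, v 2, v 3} := rfl
  simp only [aeval_esymm_eq_multiset_esymm, hu, Multiset.esymm]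
  refine ⟨?_, ?_, ?_, ?_⟩ <;>
    simp [Multiset.insert_eq_cons, Multiset.powersetCard_cons, Multiset.powersetCard_one,
      -Multiset.cons_zero, -Multiset.coe_singleton] <;> ring

theorem aeval_vdm_four (v : Fin 4 → A) : aeval v (vdm F 4) = (v 1 - v 0) * (v 2 - v 0) *
    (v 3 - v 0) * (v 2 - v 1) * (v 3 - v 1) * (v 3 - v 2) := by
  rw [vdm, Matrix.det_vandermonde, Fin.prod_univ_four,
    show Finset.Ioi (0 : Fin 4) = {1, 2, 3} by decide, show Finset.Ioi (1 : Fin 4) = {2, 3} by decide,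
    show Finset.Ioi (2 : Fin 4) = {3} by decide, show Finset.Ioi (3 : Fin 4) = ∅ by decide]
  simp
  ring

theorem aeval_esymm_three (v : Fin 3 → A) :
    aeval v (esymm (Fin 3) F 1) = v 0 + v 1 + v 2 ∧
    aeval v (esymm (Fin 3) F 2) = v 0 * v 1 + v 0 * v 2 + v 1 * v 2 ∧
    aeval v (esymm (Fin 3) F 3) = v 0 * v 1 * v 2 := by
  have hu : (Finset.univ : Finset (Fin 3)).val.map v = {v 0, v 1, v 2} := rfl
  simp only [aeval_esymm_eq_multiset_esymm, hu, Multiset.esymm]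
  refine ⟨?_, ?_, ?_⟩ <;>
    simp [Multiset.insert_eq_cons, Multiset.powersetCard_cons, Multiset.powersetCard_one,
      -Multiset.cons_zero, -Multiset.coe_singleton] <;> ring

end Evaluation

/-! ### Irredundancy of the even generators by separating points -/

section Minimality

variable {F : Type*} [Field F]

/-- An algebra cannot separate two points at which its generators agree. Coordinates in an extension
of F are allowed since some of the points need square roots. -/
theorem notMem_adjoin_of_aeval_ne {A : Type*} [CommRing A] [Algebra F A] {σ : Type*}
    {S T : Set (MvPolynomial σ F)} {s : MvPolynomial σ F} (hT : T ⊆ S) (hs : s ∉ T) (u v : σ → A)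
    (h : ∀ t ∈ S, t ≠ s → aeval u t = aeval v t) (hne : aeval u s ≠ aeval v s) :
    s ∉ Algebra.adjoin F T := by
  intro hmem
  have hle : Algebra.adjoin F T ≤ AlgHom.equalizer (aeval u) (aeval v) :=
    Algebra.adjoin_le fun t ht => h t (hT ht) fun hts => hs (hts ▸ ht)
  exact hne (hle hmem)

/-- The values of the elementary symmetric polynomials and of the Vandermonde determinant at a
point. -/
structure HasValues {A : Type*} [CommRing A] [Algebra F A] (v : Fin 4 → A) (a b c d e : A) :
    Prop where
  one : aeval v (esymm (Fin 4) F 1) = a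
  two : aeval v (esymm (Fin 4) F 2) = b
  three : aeval v (esymm (Fin 4) F 3) = c
  four : aeval v (esymm (Fin 4) F 4) = d
  vdm : aeval v (vdm F 4) = e

theorem hasValues {A : Type*} [CommRing A] [Algebra F A] (x y z w : A) :
    HasValues (F := F) ![x, y, z, w] (x + y + z + w)
      (x * y + x * z + x * w + y * z + y * w + z * w)
      (x * y * z + x * y * w + x * z * w + y * z * w) (x * y * z * w)
      ((y - x) * (z - x) * (w - x) * (z - y) * (w - y) * (w - z)) where
  one := (aeval_esymm_four _).1
  two := (aeval_esymm_four _).2.1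
  three := (aeval_esymm_four _).2.2.1
  four := (aeval_esymm_four _).2.2.2
  vdm := aeval_vdm_four _

variable {A : Type*} [CommRing A] [Algebra F A] {u v : Fin 4 → A} {T : Set (MvPolynomial (Fin 4) F)}
  {a b c d e a' b' c' d' e' : A}

theorem notMem_adjoin_esymm_two (hu : HasValues (F := F) u a b c d e)
    (hv : HasValues (F := F) v a b' c d e) (hne : b ≠ b') (hT : T ⊆ signGenerators F)
    (hs : esymm (Fin 4) F 2 ∉ T) : esymm (Fin 4) F 2 ∉ Algebra.adjoin F T := by
  refine notMem_adjoin_of_aeval_ne hT hs u v ?_ (by rwa [hu.two, hv.two])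
  rintro t (rfl | rfl | rfl | rfl | rfl | rfl | rfl) ht
  · exact absurd rfl ht
  all_goals simp only [map_mul, map_pow, hu.one, hu.three, hu.four, hu.vdm, hv.one, hv.three,
    hv.four, hv.vdm]

/-- With σ₁ = σ₃ = 0 both multiples of Δ vanish, so Δ may take different values at the two points.
-/
theorem notMem_adjoin_esymm_four (hu : HasValues (F := F) u a b c d e)
    (hv : HasValues (F := F) v a b c d' e') (hne : d ≠ d') (ha : a = 0) (hc : c = 0)
    (hT : T ⊆ signGenerators F)
    (hs : esymm (Fin 4) F 4 ∉ T) : esymm (Fin 4) F 4 ∉ Algebra.adjoin F T := by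
  refine notMem_adjoin_of_aeval_ne hT hs u v ?_ (by rwa [hu.four, hv.four])
  rintro t (rfl | rfl | rfl | rfl | rfl | rfl | rfl) ht
  rotate_left 3
  · exact absurd rfl ht
  all_goals simp only [map_mul, map_pow, hu.one, hu.two, hu.three, hu.vdm, hv.one, hv.two, hv.three,
    hv.vdm, ha, hc, zero_mul]

theorem notMem_adjoin_esymm_one_sq (hu : HasValues (F := F) u a b 0 d 0)
    (hv : HasValues (F := F) v a' b 0 d 0) (hne : a ^ 2 ≠ a' ^ 2) (hT : T ⊆ signGenerators F)
    (hs : esymm (Fin 4) F 1 ^ 2 ∉ T) : esymm (Fin 4) F 1 ^ 2 ∉ Algebra.adjoin F T := by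
  refine notMem_adjoin_of_aeval_ne hT hs u v ?_ (by rwa [map_pow, map_pow, hu.one, hv.one])
  rintro t (rfl | rfl | rfl | rfl | rfl | rfl | rfl) ht
  rotate_left 1
  · exact absurd rfl ht
  all_goals simp only [map_mul, map_pow, hu.one, hu.two, hu.three, hu.four, hu.vdm, hv.one, hv.two,
    hv.three, hv.four, hv.vdm, mul_zero]

theorem notMem_adjoin_esymm_three_sq (hu : HasValues (F := F) u 0 b c d 0)
    (hv : HasValues (F := F) v 0 b c' d 0) (hne : c ^ 2 ≠ c' ^ 2) (hT : T ⊆ signGenerators F)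
    (hs : esymm (Fin 4) F 3 ^ 2 ∉ T) : esymm (Fin 4) F 3 ^ 2 ∉ Algebra.adjoin F T := by
  refine notMem_adjoin_of_aeval_ne hT hs u v ?_ (by rwa [map_pow, map_pow, hu.three, hv.three])
  rintro t (rfl | rfl | rfl | rfl | rfl | rfl | rfl) ht
  rotate_left 4
  · exact absurd rfl ht
  all_goals simp only [map_mul, map_pow, hu.one, hu.two, hu.three, hu.four, hu.vdm, hv.one, hv.two,
    hv.three, hv.four, hv.vdm, mul_zero, zero_mul]

theorem notMem_adjoin_esymm_one_mul_three (hu : HasValues (F := F) u a b c d 0)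
    (hv : HasValues (F := F) v a b (-c) d 0) (hne : a * c ≠ a * -c) (hT : T ⊆ signGenerators F)
    (hs : esymm (Fin 4) F 1 * esymm (Fin 4) F 3 ∉ T) :
    esymm (Fin 4) F 1 * esymm (Fin 4) F 3 ∉ Algebra.adjoin F T := by
  refine notMem_adjoin_of_aeval_ne hT hs u v ?_
    (by rwa [map_mul, map_mul, hu.one, hv.one, hu.three, hv.three])
  rintro t (rfl | rfl | rfl | rfl | rfl | rfl | rfl) ht
  rotate_left 2
  · exact absurd rfl ht
  all_goals simp only [map_mul, map_pow, hu.one, hu.two, hu.three, hu.four, hu.vdm, hv.one, hv.two,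
    hv.three, hv.four, hv.vdm, mul_zero, neg_sq]

end Minimality

/-! ### Irredundancy of the odd generators, and minimality -/

section OddDegree

variable {F : Type*} [Field F]

/-- The polynomials whose components of odd degree less than `N` lie in the ideal `I`. -/
def oddTruncation {σ : Type*} (I : Ideal (MvPolynomial σ F)) (N : ℕ) :
    Subalgebra F (MvPolynomial σ F) where
  carrier := {f | ∀ i < N, Odd i → homogeneousComponent i f ∈ I}
  mul_mem' := by
    intro f g hf hg i hi ho
    rw [homogeneousComponent_mul]
    refine Ideal.sum_mem _ fun x hx => ?_
    have hx := Finset.HasAntidiagonal.mem_antidiagonal.1 hx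
    -- An odd degree is the sum of an odd and an even one, and the odd summand is still below N.
    rcases Nat.even_or_odd x.1 with h | h
    · refine I.mul_mem_left _ (hg x.2 (by omega) ?_)
      rw [Nat.odd_iff] at ho ⊢
      rw [Nat.even_iff] at h
      omega
    · exact I.mul_mem_right _ (hf x.1 (by omega) h)
  add_mem' := fun hf hg i hi ho => by
    rw [map_add]
    exact I.add_mem (hf i hi ho) (hg i hi ho)
  algebraMap_mem' := fun r i _ ho => by
    rw [algebraMap_eq, homogeneousComponent_of_mem (isHomogeneous_C _ r), if_neg]
    · exact I.zero_mem
    · rintro rfl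
      exact absurd ho (by decide)

theorem mem_oddTruncation_of_isHomogeneous {σ : Type*} {I : Ideal (MvPolynomial σ F)} {N d : ℕ}
    {f : MvPolynomial σ F} (hf : f.IsHomogeneous d) (h : d < N → Odd d → f ∈ I) :
    f ∈ oddTruncation I N := by
  intro i hi ho
  rw [homogeneousComponent_of_mem hf]
  split_ifs with hd
  · subst hd
    exact h hi ho
  · exact I.zero_mem

theorem esymm_one_ne_zero : esymm (Fin 4) F 1 ≠ 0 := by
  intro h
  have := (hasValues (F := F) (1 : F) 0 0 0).one
  rw [h, map_zero] at this
  simp at this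

/-- At the point (1, t, -1 - t, 0) over F[t], σ₁ vanishes while σ₃Δ is, up to sign, a product of
nonzero polynomials of degree one. -/
theorem esymm_three_mul_vdm_notMem (h2 : (2 : F) ≠ 0) :
    esymm (Fin 4) F 3 * vdm F 4 ∉ Ideal.span {esymm (Fin 4) F 1} := by
  intro h
  rw [Ideal.mem_span_singleton] at h
  obtain ⟨q, hq⟩ := h
  let t : Polynomial F := Polynomial.X
  have hv := hasValues (F := F) (1 : Polynomial F) t (-1 - t) 0
  have h0 := congrArg (aeval ![(1 : Polynomial F), t, -1 - t, 0]) hq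
  rw [map_mul, map_mul, hv.one, hv.three, hv.vdm] at h0
  have hp : t * (t + 1) * ((t - 1) * (t + 2) * (2 * t + 1) * t * (t + 1)) = 0 := by
    linear_combination -h0
  have ne : ∀ (p : Polynomial F) (x : F), p.eval x ≠ 0 → p ≠ 0 := by
    rintro p x hp rfl
    simp at hp
  refine absurd hp (mul_ne_zero (mul_ne_zero ?_ ?_) (mul_ne_zero (mul_ne_zero (mul_ne_zero
    (mul_ne_zero ?_ ?_) ?_) ?_) ?_))
  · exact ne _ 1 (by simp [t])
  · exact ne _ 0 (by simp [t])
  · exact ne _ 0 (by simp [t])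
  · exact ne _ 0 (by simpa [t] using h2)
  · exact ne _ 0 (by simp [t])
  · exact ne _ 1 (by simp [t])
  · exact ne _ 0 (by simp [t])

theorem esymm_three_mul_vdm_ne_zero (h2 : (2 : F) ≠ 0) : esymm (Fin 4) F 3 * vdm F 4 ≠ 0 :=
  fun h => esymm_three_mul_vdm_notMem h2 (h ▸ Ideal.zero_mem _)

theorem signGenerators_isHomogeneous :
    (esymm (Fin 4) F 2).IsHomogeneous 2 ∧ (esymm (Fin 4) F 1 ^ 2).IsHomogeneous 2 ∧
    (esymm (Fin 4) F 1 * esymm (Fin 4) F 3).IsHomogeneous 4 ∧ (esymm (Fin 4) F 4).IsHomogeneous 4 ∧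
    (esymm (Fin 4) F 3 ^ 2).IsHomogeneous 6 ∧ (esymm (Fin 4) F 1 * vdm F 4).IsHomogeneous 7 ∧
    (esymm (Fin 4) F 3 * vdm F 4).IsHomogeneous 9 := by
  have hh := fun k => esymm_isHomogeneous (F := F) (n := 4) k
  exact ⟨hh 2, (hh 1).pow 2, (hh 1).mul (hh 3), hh 4, (hh 3).pow 2,
    (hh 1).mul vdm_four_isHomogeneous, (hh 3).mul vdm_four_isHomogeneous⟩

/-- Even generators lie in every `oddTruncation`. The ideal 0 with N = 8 isolates σ₁Δ, and the ideal
(σ₁) with N = 10 isolates σ₃Δ. -/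
theorem notMem_adjoin_of_oddTruncation {T : Set (MvPolynomial (Fin 4) F)}
    {s : MvPolynomial (Fin 4) F} (hT : T ⊆ signGenerators F) (hs : s ∉ T)
    {I : Ideal (MvPolynomial (Fin 4) F)} {N d : ℕ} (hd : Odd d) (hdN : d < N)
    (hsd : s.IsHomogeneous d) (hsI : s ∉ I)
    (h7 : esymm (Fin 4) F 1 * vdm F 4 ≠ s → 7 < N → esymm (Fin 4) F 1 * vdm F 4 ∈ I)
    (h9 : esymm (Fin 4) F 3 * vdm F 4 ≠ s → 9 < N → esymm (Fin 4) F 3 * vdm F 4 ∈ I) :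
    s ∉ Algebra.adjoin F T := by
  intro hmem
  have hle : Algebra.adjoin F T ≤ oddTruncation I N := by
    refine Algebra.adjoin_le fun t ht => ?_
    have hts : t ≠ s := fun h => hs (h ▸ ht)
    obtain ⟨g1, g2, g3, g4, g5, g6, g7⟩ := signGenerators_isHomogeneous (F := F)
    rcases hT ht with rfl | rfl | rfl | rfl | rfl | rfl | rfl
    · exact mem_oddTruncation_of_isHomogeneous g1 fun _ h => absurd h (by decide)
    · exact mem_oddTruncation_of_isHomogeneous g2 fun _ h => absurd h (by decide)
    · exact mem_oddTruncation_of_isHomogeneous g3 fun _ h => absurd h (by decide)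
    · exact mem_oddTruncation_of_isHomogeneous g4 fun _ h => absurd h (by decide)
    · exact mem_oddTruncation_of_isHomogeneous g5 fun _ h => absurd h (by decide)
    · exact mem_oddTruncation_of_isHomogeneous g6 fun h _ => h7 hts h
    · exact mem_oddTruncation_of_isHomogeneous g7 fun h _ => h9 hts h
  have := hle hmem d hdN hd
  rw [homogeneousComponent_eq_self hsd] at this
  exact hsI this

theorem notMem_adjoin_esymm_one_mul_vdm {T : Set (MvPolynomial (Fin 4) F)}
    (hT : T ⊆ signGenerators F) (hs : esymm (Fin 4) F 1 * vdm F 4 ∉ T) :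
    esymm (Fin 4) F 1 * vdm F 4 ∉ Algebra.adjoin F T := by
  refine notMem_adjoin_of_oddTruncation hT hs (I := ⊥) (N := 8) (d := 7) (by decide) (by norm_num)
    signGenerators_isHomogeneous.2.2.2.2.2.1 ?_ (fun h => absurd rfl h)
    (fun _ h => absurd h (by norm_num))
  rw [Ideal.mem_bot]
  exact mul_ne_zero esymm_one_ne_zero vdm_ne_zero

theorem notMem_adjoin_esymm_three_mul_vdm (h2 : (2 : F) ≠ 0) {T : Set (MvPolynomial (Fin 4) F)}
    (hT : T ⊆ signGenerators F) (hs : esymm (Fin 4) F 3 * vdm F 4 ∉ T) :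
    esymm (Fin 4) F 3 * vdm F 4 ∉ Algebra.adjoin F T :=
  notMem_adjoin_of_oddTruncation hT hs (I := Ideal.span {esymm (Fin 4) F 1}) (N := 10) (d := 9)
    (by decide) (by norm_num) signGenerators_isHomogeneous.2.2.2.2.2.2
    (esymm_three_mul_vdm_notMem h2)
    (fun _ _ => Ideal.mul_mem_right _ _ (Ideal.subset_span rfl)) (fun h => absurd rfl h)

theorem signGenerators_minimal (h2 : (2 : F) ≠ 0) (h3 : (3 : F) ≠ 0)
    {T : Set (MvPolynomial (Fin 4) F)} (hT : T ⊆ signGenerators F) {s : MvPolynomial (Fin 4) F}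
    (hs : s ∈ signGenerators F) (hsT : s ∉ T) : s ∉ Algebra.adjoin F T := by
  let K := AlgebraicClosure F
  have k2 : (2 : K) ≠ 0 := by
    rw [← map_ofNat (algebraMap F K) 2]; simpa using h2
  have k3 : (3 : K) ≠ 0 := by
    rw [← map_ofNat (algebraMap F K) 3]; simpa using h3
  rcases hs with rfl | rfl | rfl | rfl | rfl | rfl | rfl
  · have hu := hasValues (F := F) (1 : F) (-1) 0 0
    have hv := hasValues (F := F) (0 : F) 0 0 0
    norm_num at hu hv
    exact notMem_adjoin_esymm_two hu hv (by simp) hT hsT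
  · have hu := hasValues (F := F) (1 : F) 0 0 0
    have hv := hasValues (F := F) (0 : F) 0 0 0
    norm_num at hu hv
    exact notMem_adjoin_esymm_one_sq hu hv (by simp) hT hsT
  -- Two points with a repeated coordinate, hence Δ = 0, with equal σ₁, σ₂, σ₄ and opposite σ₃. The
  -- other generators see σ₃ only squared or multiplied by Δ. The values of σ₁σ₃ differ by 2⁸ · 3⁵,
  -- which is nonzero in F.
  · obtain ⟨x, hx⟩ := IsAlgClosed.exists_pow_nat_eq (640 : K) (show 0 < 2 by norm_num)
    obtain ⟨y, hy⟩ := IsAlgClosed.exists_pow_nat_eq (352 : K) (show 0 < 2 by norm_num)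
    have hu : HasValues (F := F) ![(6 : K), 6, -4 + x, -4 - x] 4 (-684) (-7776) (-22464) 0 := by
      convert hasValues (F := F) (6 : K) 6 (-4 + x) (-4 - x) using 1
      · ring
      · linear_combination hx
      · linear_combination 12 * hx
      · linear_combination 36 * hx
      · ring
    have hv : HasValues (F := F) ![(-12 : K), -12, 14 + y, 14 - y] 4 (-684) (-(-7776)) (-22464) 0 := by
      convert hasValues (F := F) (-12 : K) (-12) (14 + y) (14 - y) using 1
      · ring
      · linear_combination hy
      · linear_combination (-24) * hy
      · linear_combination 144 * hy
      · ring
    refine notMem_adjoin_esymm_one_mul_three hu hv (fun h => ?_) hT hsT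
    have : (2 : K) ^ 8 * 3 ^ 5 = 0 := by linear_combination (-1) * h
    exact absurd this (mul_ne_zero (pow_ne_zero _ k2) (pow_ne_zero _ k3))
  -- Since 1 + 49 = 25 + 25, the values of σ₂ agree, whereas those of σ₄ are 49 and 625 and differ
  -- by 2⁶ · 3².
  · have hu := hasValues (F := F) (1 : F) (-1) 7 (-7)
    have hv := hasValues (F := F) (5 : F) (-5) 5 (-5)
    norm_num at hu hv
    refine notMem_adjoin_esymm_four hu hv (fun h => ?_) rfl rfl hT hsT
    have : (2 : F) ^ 6 * 3 ^ 2 = 0 := by linear_combination (-1) * h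
    exact absurd this (mul_ne_zero (pow_ne_zero _ h2) (pow_ne_zero _ h3))
  · obtain ⟨x, hx⟩ := IsAlgClosed.exists_pow_nat_eq (3 : K) (show 0 < 2 by norm_num)
    have hu : HasValues (F := F) ![(1 : K), 1, 0, -2] 0 (-3) (-2) 0 0 := by
      convert hasValues (F := F) (1 : K) 1 0 (-2) using 1 <;> ring
    have hv : HasValues (F := F) ![(0 : K), 0, x, -x] 0 (-3) 0 0 0 := by
      convert hasValues (F := F) (0 : K) 0 x (-x) using 1
      · ring
      · linear_combination hx
      · ring
      · ring
      · ring
    refine notMem_adjoin_esymm_three_sq hu hv (fun h => ?_) hT hsT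
    have : (2 : K) ^ 2 = 0 := by linear_combination h
    exact pow_ne_zero _ k2 this
  · exact notMem_adjoin_esymm_one_mul_vdm hT hsT
  · exact notMem_adjoin_esymm_three_mul_vdm h2 hT hsT

theorem isMinimalHomogeneousGeneratingSet_signGenerators (h2 : (2 : F) ≠ 0) (h3 : (3 : F) ≠ 0) :
    IsMinimalHomogeneousGeneratingSet (invariants (permSignRep F 4)) (signGenerators F) := by
  refine ⟨?_, adjoin_signGenerators h2, fun T hT hadj => ?_⟩
  · obtain ⟨g1, g2, g3, g4, g5, g6, g7⟩ := signGenerators_isHomogeneous (F := F)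
    rintro f (rfl | rfl | rfl | rfl | rfl | rfl | rfl)
    exacts [⟨_, g1⟩, ⟨_, g2⟩, ⟨_, g3⟩, ⟨_, g4⟩, ⟨_, g5⟩, ⟨_, g6⟩, ⟨_, g7⟩]
  · obtain ⟨s, hs, hsT⟩ := Set.exists_of_ssubset hT
    exact signGenerators_minimal h2 h3 hT.subset hs hsT (hadj ▸ signGenerators_subset hs)

end OddDegree

/-! ### Lower bound for the symmetric group of degree four -/

section SymmetricLowerBound

variable {F : Type*} [Field F]

theorem mem_oddTruncation_of_mem_invariants (h2 : (2 : F) ≠ 0) {f : MvPolynomial (Fin 4) F}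
    (hf : f ∈ invariants (permSignRep F 4)) :
    f ∈ oddTruncation (Ideal.span {esymm (Fin 4) F 1}) 9 := by
  rw [← adjoin_signGenerators h2] at hf
  refine Algebra.adjoin_le (fun t ht => ?_) hf
  obtain ⟨g1, g2, g3, g4, g5, g6, g7⟩ := signGenerators_isHomogeneous (F := F)
  rcases ht with rfl | rfl | rfl | rfl | rfl | rfl | rfl
  · exact mem_oddTruncation_of_isHomogeneous g1 fun _ h => absurd h (by decide)
  · exact mem_oddTruncation_of_isHomogeneous g2 fun _ h => absurd h (by decide)
  · exact mem_oddTruncation_of_isHomogeneous g3 fun _ h => absurd h (by decide)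
  · exact mem_oddTruncation_of_isHomogeneous g4 fun _ h => absurd h (by decide)
  · exact mem_oddTruncation_of_isHomogeneous g5 fun _ h => absurd h (by decide)
  · exact mem_oddTruncation_of_isHomogeneous g6 fun _ _ =>
      Ideal.mul_mem_right _ _ (Ideal.subset_span rfl)
  · exact mem_oddTruncation_of_isHomogeneous g7 fun h _ => absurd h (by norm_num)

theorem le_betaModule_permSignRep (h2 : (2 : F) ≠ 0) : 9 ≤ betaModule (permSignRep F 4) 1 := by
  have h9 := (signGenerators_isHomogeneous (F := F)).2.2.2.2.2.2
  refine le_betaModule (d := 9) (f := esymm (Fin 4) F 3 * vdm F 4)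
    (signGenerators_subset (by simp)) h9 (by norm_num) fun hmem => ?_
  refine esymm_three_mul_vdm_notMem h2 ?_
  rw [← homogeneousComponent_eq_self h9]
  generalize esymm (Fin 4) F 3 * vdm F 4 = f at hmem
  rw [pow_two] at hmem
  refine Submodule.mul_induction_on hmem (fun a ha b hb => ?_) fun a b ha hb => ?_
  · obtain ⟨ha, ha0⟩ := mem_posInvariants.1 ha
    obtain ⟨hb, hb0⟩ := mem_posInvariants.1 hb
    have hA := mem_oddTruncation_of_mem_invariants h2 ha
    have hB := mem_oddTruncation_of_mem_invariants h2 hb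
    -- In degree 9 both factors must have positive degree; the one of odd degree has degree below 9
    -- and hence lies in (σ₁).
    rw [homogeneousComponent_mul]
    refine Ideal.sum_mem _ fun x hx => ?_
    have hx := Finset.HasAntidiagonal.mem_antidiagonal.1 hx
    rcases Nat.eq_zero_or_pos x.1 with h1 | h1
    · rw [h1, homogeneousComponent_zero_of_mem_augmentation ha0, zero_mul]
      exact Ideal.zero_mem _
    rcases Nat.eq_zero_or_pos x.2 with h2 | h2
    · rw [h2, homogeneousComponent_zero_of_mem_augmentation hb0, mul_zero]
      exact Ideal.zero_mem _
    rcases Nat.even_or_odd x.1 with h | h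
    · refine Ideal.mul_mem_left _ _ (hB x.2 (by omega) ?_)
      rw [Nat.even_iff] at h
      rw [Nat.odd_iff]
      omega
    · exact Ideal.mul_mem_right _ _ (hA x.1 (by omega) h)
  · rw [map_add]
    exact Ideal.add_mem _ ha hb

theorem beta_S4 (h2 : (2 : F) ≠ 0) (h3 : (3 : F) ≠ 0) :
    betaModule (permSignRep F 4) 1 = 9 ∧ beta F S4 1 = 9 :=
  ⟨le_antisymm (betaModule_S4_le h2 h3 _) (le_betaModule_permSignRep h2),
    le_antisymm (iSup₂_le fun _ ρ => betaModule_S4_le h2 h3 ρ)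
      ((le_betaModule_permSignRep h2).trans (betaModule_le_beta _ 1))⟩

end SymmetricLowerBound

/-! ### Lower bound for the dihedral group of order six -/

section DihedralLowerBound

variable {F : Type*} [Field F]

/-- The action of the dihedral group of order six on the vertices of the triangle. -/
def dihedralToPerm : DihedralGroup 3 →* Equiv.Perm (Fin 3) where
  toFun
    | .r i => Equiv.addLeft (i : Fin 3)
    | .sr i => Equiv.subLeft (-i : Fin 3)
  map_one' := by decide
  map_mul' := by decide

theorem dihedralToPerm_surjective : Function.Surjective dihedralToPerm := by decide

/-- The permutation representation on the vertices of the triangle, tensored with the sign. -/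
def dihedralRep (F : Type*) [Field F] : Representation F (DihedralGroup 3) (Fin 3 → F) :=
  (permSignRep F 3).comp dihedralToPerm

theorem mem_invariants_dihedralRep {f : MvPolynomial (Fin 3) F} :
    f ∈ invariants (dihedralRep F) ↔ f ∈ invariants (permSignRep F 3) := by
  have h : ∀ g, polyAct (dihedralRep F) g f = polyAct (permSignRep F 3) (dihedralToPerm g) f := by
    intro g
    simp only [polyAct, dihedralRep, MonoidHom.comp_apply, map_inv]
  constructor
  · intro hf g
    obtain ⟨g, rfl⟩ := dihedralToPerm_surjective g
    rw [← h, hf g]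
  · intro hf g
    rw [h, hf]

/-- Odd invariants are multiples of Δ₃, which has degree 3. -/
theorem homogeneousComponent_one_eq_zero_of_dihedralRep (h2 : (2 : F) ≠ 0)
    {f : MvPolynomial (Fin 3) F} (hf : f ∈ invariants (permSignRep F 3)) :
    homogeneousComponent 1 f = 0 := by
  by_contra h0
  obtain ⟨e, q, h1, -⟩ := exists_eq_vdm_mul_of_odd h2 (d := 1) (by decide)
    (homogeneousComponent_mem_invariants hf 1) (homogeneousComponent_isHomogeneous 1 f) h0
  rw [vdmDegree_three] at h1
  omega

/-- Symmetric quadratic polynomials do not separate points on which the first two elementary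
symmetric polynomials agree. -/
theorem aeval_eq_of_isHomogeneous_two {u v : Fin 3 → F}
    (h1 : aeval u (esymm (Fin 3) F 1) = aeval v (esymm (Fin 3) F 1))
    (h2 : aeval u (esymm (Fin 3) F 2) = aeval v (esymm (Fin 3) F 2))
    {q : MvPolynomial (Fin 3) F} (hq : q.IsSymmetric) (hqd : q.IsHomogeneous 2) :
    aeval u q = aeval v q := by
  refine (Submodule.span_le (p := LinearMap.eqLocus (aeval u : _ →ₐ[F] F).toLinearMap
    (aeval v : _ →ₐ[F] F).toLinearMap)).2 ?_ (mem_span_esymm hqd hq)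
  rintro _ ⟨m, hm, rfl⟩
  rw [Fin.sum_univ_three] at hm
  simp only [Fin.val_zero, Fin.val_one, Fin.val_two] at hm
  have h0 : m 2 = 0 := by omega
  change aeval u _ = aeval v _
  rw [Fin.prod_univ_three, h0]
  simp only [map_mul, map_pow, Fin.val_zero, Fin.val_one, zero_add, pow_zero, mul_one, h1,
    Nat.reduceAdd, h2]

/-- There are no linear invariants, so a decomposable invariant of degree 4 is a sum of products of
two quadratic ones, which are polynomials in σ₁ and σ₂. These take equal values at (2, 2, -1) and
(3, 0, 0), where σ₁σ₃ is -12 and 0. -/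
theorem le_beta_dihedral (h2 : (2 : F) ≠ 0) (h3 : (3 : F) ≠ 0) :
    4 ≤ beta F (DihedralGroup 3) 1 := by
  refine le_trans ?_ (betaModule_le_beta (dihedralRep F) 1)
  have h4 : (esymm (Fin 3) F 1 * esymm (Fin 3) F 3).IsHomogeneous 4 :=
    (esymm_isHomogeneous 1).mul (esymm_isHomogeneous 3)
  refine le_betaModule (d := 4) (f := esymm (Fin 3) F 1 * esymm (Fin 3) F 3) ?_ h4 (by norm_num)
    fun hmem => ?_
  · rw [mem_invariants_dihedralRep, mem_invariants_permSignRep_even (by decide) h4]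
    exact (esymm_isSymmetric _ _ _).mul (esymm_isSymmetric _ _ _)
  obtain ⟨u1, u2, u3⟩ := aeval_esymm_three (F := F) ![(2 : F), 2, -1]
  obtain ⟨v1, v2, v3⟩ := aeval_esymm_three (F := F) ![(3 : F), 0, 0]
  have e1 : aeval ![(2 : F), 2, -1] (esymm (Fin 3) F 1) =
      aeval ![(3 : F), 0, 0] (esymm (Fin 3) F 1) := by
    rw [u1, v1]; simp only [Matrix.cons_val]; ring
  have e2 : aeval ![(2 : F), 2, -1] (esymm (Fin 3) F 2) =
      aeval ![(3 : F), 0, 0] (esymm (Fin 3) F 2) := by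
    rw [u2, v2]; simp only [Matrix.cons_val]; ring
  have key : ∀ f ∈ posInvariants (dihedralRep F) ^ 2,
      aeval ![(2 : F), 2, -1] (homogeneousComponent 4 f) =
        aeval ![(3 : F), 0, 0] (homogeneousComponent 4 f) := by
    intro f hf
    rw [pow_two] at hf
    refine Submodule.mul_induction_on hf (fun a ha b hb => ?_) fun a b ha hb => ?_
    · obtain ⟨ha, ha0⟩ := mem_posInvariants.1 ha
      obtain ⟨hb, hb0⟩ := mem_posInvariants.1 hb
      rw [mem_invariants_dihedralRep] at ha hb
      have hcomp : homogeneousComponent 4 (a * b) =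
          homogeneousComponent 2 a * homogeneousComponent 2 b := by
        rw [homogeneousComponent_mul, Finset.sum_eq_single (2, 2)]
        · intro x hx hne
          have hx := Finset.HasAntidiagonal.mem_antidiagonal.1 hx
          obtain h | h | h | h | h : x.1 = 0 ∨ x.1 = 1 ∨ x.1 = 2 ∨ x.2 = 0 ∨ x.2 = 1 := by omega
          · rw [h, homogeneousComponent_zero_of_mem_augmentation ha0, zero_mul]
          · rw [h, homogeneousComponent_one_eq_zero_of_dihedralRep h2 ha, zero_mul]
          · exact absurd (Prod.ext_iff.2 ⟨h, by simp only; omega⟩) hne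
          · rw [h, homogeneousComponent_zero_of_mem_augmentation hb0, mul_zero]
          · rw [h, homogeneousComponent_one_eq_zero_of_dihedralRep h2 hb, mul_zero]
        · intro h
          exact absurd (by decide) h
      have hsym : ∀ g ∈ invariants (permSignRep F 3), (homogeneousComponent 2 g).IsSymmetric :=
        fun g hg => (mem_invariants_permSignRep_even (by decide)
          (homogeneousComponent_isHomogeneous 2 g)).1 (homogeneousComponent_mem_invariants hg 2)
      rw [hcomp, map_mul, map_mul,
        aeval_eq_of_isHomogeneous_two e1 e2 (hsym a ha) (homogeneousComponent_isHomogeneous 2 a),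
        aeval_eq_of_isHomogeneous_two e1 e2 (hsym b hb) (homogeneousComponent_isHomogeneous 2 b)]
    · rw [map_add, map_add, map_add, ha, hb]
  have h := key _ hmem
  rw [homogeneousComponent_eq_self h4, map_mul, map_mul, u1, u3, v1, v3] at h
  simp only [Matrix.cons_val] at h
  have : (2 : F) ^ 2 * 3 = 0 := by linear_combination -h
  exact absurd this (mul_ne_zero (pow_ne_zero _ h2) h3)

theorem beta_dihedral (h2 : (2 : F) ≠ 0) (h3 : (3 : F) ≠ 0) : beta F (DihedralGroup 3) 1 = 4 :=
  le_antisymm (iSup₂_le fun _ ρ => betaModule_dihedral_le h2 h3 ρ) (le_beta_dihedral h2 h3)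

end DihedralLowerBound

end NoetherNumber

open NoetherNumber in
theorem mainTheorem11 {F : Type*} [Field F] (hF : ¬ ringChar F ∣ Nat.card S4) :
    -- the Noether number of the symmetric group of degree four
    beta F S4 1 = 9 ∧
    -- the upper bound through a normal subgroup; `DihedralGroup 3` is the dihedral group of order 6
    (∃ (N : Subgroup S4) (_ : N.Normal),
      Nonempty (N ≃* KleinFour) ∧ Nonempty (S4 ⧸ N ≃* DihedralGroup 3)) ∧
    beta F (DihedralGroup 3) 1 = 4 ∧
    beta F S4 1 ≤ beta F KleinFour 4 ∧
    beta F KleinFour 4 = davenport KleinFour 4 ∧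
    davenport KleinFour 4 = 9 ∧
    -- the invariants of `V ⊗ sign` are the direct sum of the even part of the symmetric
    -- polynomials and the Vandermonde determinant times their odd part
    Subalgebra.toSubmodule (invariants (permSignRep F 4)) =
      evenPart (invariants (permRep F 4)) ⊔
        (oddPart (invariants (permRep F 4))).map (LinearMap.mulLeft F (vdm F 4)) ∧
    Disjoint (evenPart (invariants (permRep F 4)))
      ((oddPart (invariants (permRep F 4))).map (LinearMap.mulLeft F (vdm F 4))) ∧
    -- a minimal homogeneous generating set, and the generator of degree nine
    IsMinimalHomogeneousGeneratingSet (invariants (permSignRep F 4))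
      {MvPolynomial.esymm (Fin 4) F 2,
        MvPolynomial.esymm (Fin 4) F 1 ^ 2,
        MvPolynomial.esymm (Fin 4) F 1 * MvPolynomial.esymm (Fin 4) F 3,
        MvPolynomial.esymm (Fin 4) F 4,
        MvPolynomial.esymm (Fin 4) F 3 ^ 2,
        MvPolynomial.esymm (Fin 4) F 1 * vdm F 4,
        MvPolynomial.esymm (Fin 4) F 3 * vdm F 4} ∧
    (MvPolynomial.esymm (Fin 4) F 3 * vdm F 4).totalDegree = 9 ∧
    betaModule (permSignRep F 4) 1 = 9 := by
  obtain ⟨h2, h3⟩ := two_ne_zero_and_three_ne_zero hF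
  obtain ⟨hV, hS⟩ := beta_S4 h2 h3
  refine ⟨hS, exists_normal_klein, beta_dihedral h2 h3, ?_, ?_, davenport_kleinFour,
    toSubmodule_invariants_permSignRep h2, disjoint_even_vdm_mul_odd h2,
    isMinimalHomogeneousGeneratingSet_signGenerators h2 h3, ?_, hV⟩
  · rw [hS, beta_kleinFour h2]
  · rw [beta_kleinFour h2, davenport_kleinFour]
  · exact signGenerators_isHomogeneous.2.2.2.2.2.2.totalDegree (esymm_three_mul_vdm_ne_zero h2)
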